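/- **Setting.** A base station with $M$ antennas serves $K$ users over $N\ge 1$ subcarriers. User $k$ has large-scale gain $\gamma[k]>0$, $\tau[k]>0$ uplink pilots of power $p_\tau[k]>0$, power budget $P[k]>0$, maximal tolerated error rate $\epsilon_{\max}[k]>0$ and utilization factor $\rho[k]\in(0,1)$; $L>0$ is the number of bits per packet, and $\lambda[k]=\rho[k]\,N\log M/L$ packets arrive per frame. All these parameters except $\lambda[k]$ are independent of $M$. The noise has power $1$ and the inter-cell interference has power $p_I\ge 0$. The channel estimates $\hat{\mathbf H}_n\in\mathbb C^{M\times K}$, $n=1,\dots,N$, have independent entries, those of column $k$ being circularly symmetric complex Gaussian with variance $\frac{\tau[k]p_\tau[k]\gamma[k]}{\tau[k]p_\tau[k]\gamma[k]+1}$. Replacing the inter-beam interference by the worst-case value $K/\tau[k]$, the SINR of user $k$ on subcarrier $n$ after zero forcing, at transmit power $p$, is $$\mathrm{SINR}_n[k]=\frac{p\,\gamma[k]}{(1+p_I+K/\tau[k])\,[(\hat{\mathbf H}_n^H\hat{\mathbf H}_n)^{-1}]_{kk}} .$$ A frame in which $r$ packets are sent at power $p$ has block error rate $\mathrm{Prob}[\sum_n\log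 \mathrm{SINR}_n[k]\le rL]$. Let $\eta=\eta[k]=\bigl(\prod_{n}\kappa_n\bigr)^{1/N}$ with $\kappa_n=\{M[(\hat{\mathbf H}_n^H\hat{\mathbf H}_n)^{-1}]_{kk}\}^{-1}$, let $F_\eta$ be its cumulative distribution function and $F_\eta^{-1}(\epsilon)=\inf\{x>0:\epsilon\le F_\eta(x)\}$. The queue of each user has infinite buffer, $q_0=0$ and $q_{t+1}=\max(q_t+\lambda-1_t r_t,\lambda)$, where $r_t=\mu(q_t)\ge 0$ is a stationary rate policy and the success indicators $1_t$ are independent with $\mathrm{Prob}[1_t=1]=1-\epsilon$. Long-term averages are $\limsup_{T}\frac1T\sum_{t<T}E[\cdot]$; the latency $D$ is the long-term average of $q_t/\lambda$. *Single-user problem of user $k$*: $D^*[k]$ is the infimum of $D$ over $\epsilon\in(0,1)$ with $\epsilon\le\epsilon_{\max}[k]$ and policies $\mu$, such that the long-term average of $p(r_t,\epsilon)$ is at most $P[k]$, where $p(r,\epsilon)=(1+\frac K{\tau[k]}+p_I)\frac{\exp(rL/N)}{F_\eta^{-1}(\epsilon)M\gamma[k]}$. *Multiuser problem* for weights $\omega_k>0$: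 minimize $\sum_k\omega_kD[k]$ over target error rates $\epsilon[k]$ and rate policies $r_t[k]=\mu_k(q_t[k])$ as above, and positive transmit powers $p_k(q_t[k])$, such that for every user and every queue length the block error rate equals $\epsilon[k]$, and the long-term average power is at most $P[k]$. **Theorem.** (a) For $M\ge\max(2,K)$ the multiuser problem decouples into the $K$ single-user problems: its optimal value is $\sum_k\omega_kD^*[k]$. (b) Let multiuser LYRRC be the control $$\epsilon^*[k]=F_\eta\Bigl[\frac1{M^{1-\rho[k]}}\Bigl(1+\frac K{\tau[k]}+p_I\Bigr)\frac1{\gamma[k]P[k]}\Bigr],\qquad r_t[k]=\min(q_t[k],2\lambda[k]).$$ For every user $k$, as $M\to\infty$: eventually $0<\epsilon^*[k]<1$ and $\epsilon^*[k]\le\epsilon_{\max}[k]$; the average power of LYRRC tends to $P[k]$; the latency $D_{\mathrm{LYRRC}}[k]$ of LYRRC and the minimum latency $D^*[k]$ are eventually finite, and $$D_{\mathrm{LYRRC}}[k]-1\cong\epsilon^*[k],\qquad D^*[k]-1\cong\epsilon^*[k],$$ where $f_1(M)\cong f_2(M)$ means $\lim_{M\to\infty}f_1(M)/f_2(M)=1$.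 -/

import Mathlib

open MeasureTheory ProbabilityTheory Filter Topology
open scoped ENNReal Matrix

noncomputable section

/-- Parameters of a `K`-user massive MIMO uplink which do not depend on the number of antennas. -/
structure Uplink (K : ℕ) where
  /-- number of subcarriers -/
  N : ℕ
  /-- number of information bits per packet -/
  L : ℝ
  /-- power of the inter-cell interference (the receiver noise has power one) -/
  pI : ℝ
  /-- large-scale channel gain of each user -/
  γ : Fin K → ℝ
  /-- number of uplink pilots of each user -/
  τ : Fin K → ℝ
  /-- power of each pilot -/
  pτ : Fin K → ℝ
  /-- long-term transmit power budget of each user -/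
  P : Fin K → ℝ
  /-- utilization factor of each user -/
  ρ : Fin K → ℝ
  /-- largest target error rate that each user tolerates -/
  εmax : Fin K → ℝ
  N_pos : 0 < N
  L_pos : 0 < L
  pI_nonneg : 0 ≤ pI
  γ_pos : ∀ k, 0 < γ k
  τ_pos : ∀ k, 0 < τ k
  pτ_pos : ∀ k, 0 < pτ k
  P_pos : ∀ k, 0 < P k
  ρ_pos : ∀ k, 0 < ρ k
  ρ_lt_one : ∀ k, ρ k < 1
  εmax_pos : ∀ k, 0 < εmax k

/-- The circularly symmetric complex Gaussian law with mean zero and variance `v`: independent real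
and imaginary parts, each of variance `v / 2`. -/
def complexGaussian (v : ℝ) : Measure ℂ :=
  ((gaussianReal 0 (v / 2).toNNReal).prod (gaussianReal 0 (v / 2).toNNReal)).map
    Complex.measurableEquivRealProd.symm

instance (v : ℝ) : IsProbabilityMeasure (complexGaussian v) :=
  Measure.isProbabilityMeasure_map Complex.measurableEquivRealProd.symm.measurable.aemeasurable

/-- The diagonal entry `[(Hᴴ H)⁻¹]_{kk}`, a real number because `Hᴴ H` is Hermitian. -/
def invGramDiag {M K : ℕ} (H : Fin M → Fin K → ℂ) (k : Fin K) : ℝ :=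
  ((((Matrix.of H)ᴴ * Matrix.of H)⁻¹) k k).re

/-- The per-antenna gain of user `k` under zero forcing with the estimated channel `H`. -/
def perAntennaGain {M K : ℕ} (H : Fin M → Fin K → ℂ) (k : Fin K) : ℝ :=
  ((M : ℝ) * invGramDiag H k)⁻¹

/-- The queue length (infinite buffer, empty at time `0`) when `lam` packets arrive per frame,
`μ q` packets are transmitted in a frame that starts with queue length `q`, and `s t` tells whether
the transmission in frame `t` succeeds. -/
def queue (lam : ℝ) (μ : ℝ → ℝ) (s : ℕ → Bool) : ℕ → ℝ
  | 0 => 0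
  | t + 1 => max (queue lam μ s t + lam - (if s t then μ (queue lam μ s t) else 0)) lam

/-- The law of the decoding successes: independent over the frames, each a success with
probability `1 - ε`. -/
def successLaw (ε : unitInterval) : Measure (ℕ → Bool) :=
  Measure.infinitePi fun _ => bernoulliMeasure true false (unitInterval.symm ε)

/-- Long-run expected average of the per-frame cost `c (q_t)`. -/
def longRunAverage (ε : unitInterval) (lam : ℝ) (μ c : ℝ → ℝ) : ℝ≥0∞ :=
  limsup (fun T : ℕ =>
    (∑ t ∈ Finset.range T, ∫⁻ s, ENNReal.ofReal (c (queue lam μ s t)) ∂(successLaw ε)) / (T : ℝ≥0∞))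
    atTop

/-- Average latency in frames (average queue length over arrival rate). -/
def latency (ε : unitInterval) (lam : ℝ) (μ : ℝ → ℝ) : ℝ≥0∞ :=
  longRunAverage ε lam μ fun q => q / lam

namespace Uplink

variable {K : ℕ} (S : Uplink K)

/-- Arrival rate of user `k`, so that `ρ = λ L / (N log M)`. -/
def arrival (M : ℕ) (k : Fin K) : ℝ := S.ρ k * S.N * Real.log M / S.L

/-- Variance of an entry of the MMSE channel estimate of user `k`. -/
def estVar (k : Fin K) : ℝ := S.τ k * S.pτ k * S.γ k / (S.τ k * S.pτ k * S.γ k + 1)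

/-- Law of the estimated channel: for every subcarrier `n` an `M × K` matrix; all entries are
independent, and those of user `k` are complex Gaussian with variance `estVar k`. -/
def channelLaw (M : ℕ) : Measure (Fin S.N → Fin M → Fin K → ℂ) :=
  Measure.pi fun _ => Measure.pi fun _ => Measure.pi fun k => complexGaussian (S.estVar k)

instance (M : ℕ) : IsProbabilityMeasure (S.channelLaw M) := by
  unfold channelLaw; infer_instance

/-- Effective channel gain of user `k`: geometric mean over the subcarriers of the per-antenna
gains. -/
def effectiveGain {M : ℕ} (H : Fin S.N → Fin M → Fin K → ℂ) (k : Fin K) : ℝ :=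
  (∏ n, perAntennaGain (H n) k) ^ (1 / (S.N : ℝ))

/-- The cumulative distribution function of the effective channel gain of user `k`. -/
def gainCDF (M : ℕ) (k : Fin K) (x : ℝ) : unitInterval :=
  ⟨(S.channelLaw M).real {H | S.effectiveGain H k ≤ x}, measureReal_nonneg, measureReal_le_one⟩

/-- The inverse of the cumulative distribution function. -/
def gainInvCDF (M : ℕ) (k : Fin K) (ε : unitInterval) : ℝ :=
  sInf {x : ℝ | 0 < x ∧ ε ≤ S.gainCDF M k x}

/-- SINR of user `k` on a subcarrier with estimated channel `H` and transmit power `p`, when the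
inter-beam interference takes its worst-case value `K / τ`. -/
def sinr {M : ℕ} (H : Fin M → Fin K → ℂ) (k : Fin K) (p : ℝ) : ℝ :=
  p * S.γ k / ((1 + S.pI + K / S.τ k) * invGramDiag H k)

/-- Block error rate of user `k` when `r` packets are transmitted with power `p`. -/
def blockErrorRate (M : ℕ) (k : Fin K) (p r : ℝ) : ℝ :=
  (S.channelLaw M).real {H | ∑ n, Real.log (S.sinr (H n) k p) ≤ r * S.L}

/-- The decision variables of one user: target error rate, transmission rate as a function of the
queue length. -/
def IsControl (k : Fin K) (ε : unitInterval) (μ : ℝ → ℝ) : Prop :=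
  0 < (ε : ℝ) ∧ (ε : ℝ) < 1 ∧ (ε : ℝ) ≤ S.εmax k ∧ ∀ q, 0 ≤ q → 0 ≤ μ q

/-- The minimum weighted sum latency of the `K`-user problem. Besides its target error rate `ε k`
and its rate policy `μ k`, each user `k` chooses a transmit power `p k q` for every queue length
`q`; the power has to realize the target error rate and to satisfy the long-term power budget. -/
def multiuserLatency (ω : Fin K → ℝ) (M : ℕ) : ℝ≥0∞ :=
  ⨅ (ε : Fin K → unitInterval) (μ : Fin K → ℝ → ℝ) (p : Fin K → ℝ → ℝ)
    (_ : ∀ k, S.IsControl k (ε k) (μ k) ∧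
      (∀ q, 0 ≤ q → 0 < p k q ∧ (ε k : ℝ) = S.blockErrorRate M k (p k q) (μ k q)) ∧
      longRunAverage (ε k) (S.arrival M k) (μ k) (p k) ≤ ENNReal.ofReal (S.P k)),
    ∑ k, ENNReal.ofReal (ω k) * latency (ε k) (S.arrival M k) (μ k)

/-- The single-user power mapping of user `k`: transmit power for rate `r` and target error
rate `ε`. -/
def powerMap (M : ℕ) (k : Fin K) (r : ℝ) (ε : unitInterval) : ℝ :=
  (1 + K / S.τ k + S.pI) * (Real.exp (r * S.L / S.N) / (S.gainInvCDF M k ε * M * S.γ k))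

/-- Long-term average transmit power of user `k` under the power mapping. -/
def averagePower (M : ℕ) (k : Fin K) (ε : unitInterval) (μ : ℝ → ℝ) : ℝ≥0∞ :=
  longRunAverage ε (S.arrival M k) μ fun q => S.powerMap M k (μ q) ε

/-- The minimum latency `D*[k]` of the single-user problem of user `k`. -/
def minLatency (M : ℕ) (k : Fin K) : ℝ≥0∞ :=
  ⨅ (ε : unitInterval) (μ : ℝ → ℝ)
    (_ : S.IsControl k ε μ ∧ S.averagePower M k ε μ ≤ ENNReal.ofReal (S.P k)),
    latency ε (S.arrival M k) μ

/-- The target error rate of LYRRC. -/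
def lyrrcError (M : ℕ) (k : Fin K) : unitInterval :=
  S.gainCDF M k
    (1 / (M : ℝ) ^ (1 - S.ρ k) * (1 + K / S.τ k + S.pI) * (1 / (S.γ k * S.P k)))

/-- The transmission rate policy of LYRRC. -/
def lyrrcRate (M : ℕ) (k : Fin K) (q : ℝ) : ℝ := min q (2 * S.arrival M k)

/-- The latency of user `k` under LYRRC. -/
def lyrrcLatency (M : ℕ) (k : Fin K) : ℝ≥0∞ :=
  latency (S.lyrrcError M k) (S.arrival M k) (S.lyrrcRate M k)

end Uplink

end

/-!
The proof has a queueing half and a random matrix half, which meet in the effective channel gain.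

Queue. From time one on the queue holds at least one frame's arrivals, and after a failure those of
two frames, so every control with error rate `ε` has latency at least `1 + ε`
(`one_add_le_latency`). If the latency is finite, the queue is stable and on average at least `lam`
packets are sent per frame; since the exponential lies above its tangents, the average power is at
least the power for sending `lam` packets in every frame (`le_longRunAverage_exp`). The power budget
thus bounds the inverse distribution function at `ε` from below, that is `ε` is at least the
error rate of LYRRC, and the minimum latency is at least `1 + ε*`. Conversely, under the
LYRRC rate policy the queue is a birth-death chain dominated by a geometric law
(`lintegral_queue_gt_le`), so that the latency is at most `1 + ε / (1 - 2 ε)` and the average power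
exceeds the power for `lam` packets only by a relative amount of order `M ^ ρ ε`.

Gain. Shrinking a Gaussian channel increases its density at most by a power of the scaling factor,
so the distribution function `F` of the effective gain satisfies `F (c x) ≤ c ^ (K M N) F x` for
`c ≥ 1`. This makes `F` continuous on the positive reals and strictly increasing where it is below
one, hence honestly invertible, which gives the decoupling: the only power which realizes a target
error rate is the one in the power mapping of the single-user problem.
The same inequality shows that enlarging the gain by the factor `1 + M⁻²`, which suffices to make
LYRRC feasible, does not change the error rate asymptotically. What remains is that `ε*` decays
faster than every power of `M`. The zero-forcing gain `1 / [(Hᴴ H)⁻¹]_{kk}` is the minimum of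
`‖H a‖ ^ 2` over `a k = 1`, so stacking blocks of antennas adds at least their gains
(`add_zfGain_le_zfGain_append`); its Laplace transform is then submultiplicative in the number of
antennas, and a Chernoff bound over blocks of `K` antennas, on which the gain is almost surely
positive, gives exponential decay (`exists_measure_zfGain_le`).
-/

noncomputable section

/-! ### The queue driven by independent decoding successes -/

section Queue

instance (ε : unitInterval) : IsProbabilityMeasure (successLaw ε) := by
  unfold successLaw; infer_instance

lemma queue_nonneg {lam : ℝ} (hlam : 0 ≤ lam) (μ : ℝ → ℝ) (s : ℕ → Bool) (t : ℕ) :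
    0 ≤ queue lam μ s t := by
  cases t with
  | zero => exact le_rfl
  | succ t => exact hlam.trans (le_max_right _ _)

lemma arrival_le_queue (lam : ℝ) (μ : ℝ → ℝ) (s : ℕ → Bool) {t : ℕ} (ht : 1 ≤ t) :
    lam ≤ queue lam μ s t := by
  obtain ⟨t, rfl⟩ := Nat.exists_eq_add_of_le' ht
  exact le_max_right _ _

/-- The queue length at time `t` depends only on the successes before time `t`. -/
lemma queue_congr (lam : ℝ) (μ : ℝ → ℝ) {s s' : ℕ → Bool} (t : ℕ) (h : ∀ i < t, s i = s' i) :
    queue lam μ s t = queue lam μ s' t := by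
  induction t with
  | zero => rfl
  | succ t ih =>
    rw [queue, queue, ih fun i hi => h i (hi.trans t.lt_succ_self), h t t.lt_succ_self]

/-- The queue length at time `t` as a function of the first `t` successes. -/
def queueOfPrefix (lam : ℝ) (μ : ℝ → ℝ) (t : ℕ) (x : Finset.range t → Bool) : ℝ :=
  queue lam μ (fun i => if h : i ∈ Finset.range t then x ⟨i, h⟩ else false) t

lemma queue_eq_queueOfPrefix (lam : ℝ) (μ : ℝ → ℝ) (t : ℕ) (s : ℕ → Bool) :
    queue lam μ s t = queueOfPrefix lam μ t fun i => s i := by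
  refine queue_congr lam μ t fun i hi => ?_
  simp [hi]

/-- No measurability of `μ` or `f` is needed because `queue lam μ s t` takes finitely many values,
determined by finitely many coordinates of `s`. -/
lemma measurable_comp_queue {β : Type*} [MeasurableSpace β] (f : ℝ → β) (lam : ℝ) (μ : ℝ → ℝ)
    (t : ℕ) : Measurable fun s => f (queue lam μ s t) := by
  have h : (fun s => f (queue lam μ s t)) =
      (fun x => f (queueOfPrefix lam μ t x)) ∘ fun s (i : Finset.range t) => s i := by
    funext s
    simp [queue_eq_queueOfPrefix]
  rw [h]
  exact (measurable_of_finite _).comp (by fun_prop)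

lemma successLaw_apply (ε : unitInterval) (t : ℕ) (b : Bool) :
    successLaw ε {s | s t = b} = ENNReal.ofReal (if b then 1 - (ε : ℝ) else ε) := by
  have h : successLaw ε {s | s t = b} =
      ((successLaw ε).map (fun s => s t)) {b} := by
    rw [Measure.map_apply (measurable_pi_apply t) (measurableSet_singleton b)]
    rfl
  have h2 : (successLaw ε).map (fun s => s t) =
      bernoulliMeasure true false (unitInterval.symm ε) :=
    Measure.infinitePi_map_eval _ t
  rw [h, h2]
  cases b
  · rw [bernoulliMeasure_apply_of_notMem_of_mem _ (measurableSet_singleton _) (by simp) (by simp)]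
    simp only [Bool.false_eq_true, if_false, unitInterval.symm_symm]
    exact (ENNReal.ofReal_eq_coe_nnreal ε.2.1).symm
  · rw [bernoulliMeasure_apply_of_mem_of_notMem _ (measurableSet_singleton _) (by simp) (by simp)]
    exact (ENNReal.ofReal_eq_coe_nnreal (unitInterval.symm ε).2.1).symm

/-- Averages over the success of frame `t` and over the queue length at time `t` decouple. -/
lemma lintegral_ite_mul_queue (ε : unitInterval) (lam : ℝ) (μ : ℝ → ℝ) (g : ℝ → ℝ≥0∞) (t : ℕ)
    (b : Bool) :
    ∫⁻ s, (if s t = b then 1 else 0) * g (queue lam μ s t) ∂(successLaw ε) =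
      ENNReal.ofReal (if b then 1 - (ε : ℝ) else ε) *
        ∫⁻ s, g (queue lam μ s t) ∂(successLaw ε) := by
  have hind : iIndepFun (fun (i : ℕ) (s : ℕ → Bool) => s i) (successLaw ε) :=
    iIndepFun_infinitePi (X := fun _ x => x) fun _ => measurable_id
  have h1 := hind.indepFun_finset {t} (Finset.range t) (by simp) fun i => measurable_pi_apply i
  have h2 : IndepFun (fun s : ℕ → Bool => if s t = b then (1 : ℝ≥0∞) else 0)
      (fun s => g (queue lam μ s t)) (successLaw ε) := by
    have h3 := h1.comp
      (φ := fun x : ({t} : Finset ℕ) → Bool => if x ⟨t, by simp⟩ = b then (1 : ℝ≥0∞) else 0)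
      (ψ := fun x => g (queueOfPrefix lam μ t x)) (measurable_of_finite _) (measurable_of_finite _)
    simp only [queue_eq_queueOfPrefix]
    exact h3
  have hm : MeasurableSet {s : ℕ → Bool | s t = b} :=
    measurableSet_eq_fun (measurable_pi_apply t) measurable_const
  have h4 := lintegral_mul_eq_lintegral_mul_lintegral_of_indepFun
    (Measurable.ite hm measurable_const measurable_const) (measurable_comp_queue g lam μ t) h2
  simp only [Pi.mul_apply] at h4
  rw [h4, ← successLaw_apply ε t b, ← lintegral_indicator_one hm]
  congr 2 with s
  simp [Set.indicator_apply]

/-- One step of the queue: `q_{t+1}` arises from `q_t` by a failure with probability `ε`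
and by a success with probability `1 - ε`. -/
lemma lintegral_queue_succ (ε : unitInterval) (lam : ℝ) (μ : ℝ → ℝ) (g : ℝ → ℝ≥0∞) (t : ℕ) :
    ∫⁻ s, g (queue lam μ s (t + 1)) ∂(successLaw ε) =
      ENNReal.ofReal ε * ∫⁻ s, g (max (queue lam μ s t + lam) lam) ∂(successLaw ε) +
      ENNReal.ofReal (1 - ε) *
        ∫⁻ s, g (max (queue lam μ s t + lam - μ (queue lam μ s t)) lam) ∂(successLaw ε) := by
  have h1 := lintegral_ite_mul_queue ε lam μ (fun q => g (max (q + lam) lam)) t false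
  have h2 := lintegral_ite_mul_queue ε lam μ (fun q => g (max (q + lam - μ q) lam)) t true
  simp only [Bool.false_eq_true, if_false, if_true] at h1 h2
  rw [← h1, ← h2, ← lintegral_add_left]
  · refine lintegral_congr fun s => ?_
    rw [queue]
    cases s t <;> simp
  · exact (Measurable.ite (measurable_pi_apply t (measurableSet_singleton false))
      measurable_const measurable_const).mul
        (measurable_comp_queue (fun q => g (max (q + lam) lam)) lam μ t)

lemma ofReal_add_ofReal_one_sub (ε : unitInterval) :
    ENNReal.ofReal ε + ENNReal.ofReal (1 - (ε : ℝ)) = 1 := by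
  rw [← ENNReal.ofReal_add ε.2.1 (sub_nonneg.2 ε.2.2)]
  simp

lemma lintegral_comp_queue_ne_top (ε : unitInterval) (lam : ℝ) (μ f : ℝ → ℝ) (t : ℕ) :
    ∫⁻ s, ENNReal.ofReal (f (queue lam μ s t)) ∂(successLaw ε) ≠ ∞ := by
  have h : ∃ C : ℝ, ∀ s, f (queue lam μ s t) ≤ C := by
    obtain ⟨C, hC⟩ := (Set.finite_range fun x => f (queueOfPrefix lam μ t x)).bddAbove
    refine ⟨C, fun s => ?_⟩
    rw [queue_eq_queueOfPrefix]
    exact hC ⟨_, rfl⟩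
  obtain ⟨C, hC⟩ := h
  refine ne_top_of_le_ne_top (b := ENNReal.ofReal C) ENNReal.ofReal_ne_top ?_
  calc _ ≤ ∫⁻ _, ENNReal.ofReal C ∂(successLaw ε) :=
        lintegral_mono fun s => ENNReal.ofReal_le_ofReal (hC s)
    _ = _ := by simp

/-! ### Bounds on long-run averages -/

/-- A lower bound on the expected cost in every frame but the first two bounds the long-run
average. -/
lemma le_longRunAverage (ε : unitInterval) (lam : ℝ) (μ c : ℝ → ℝ) (a : ℝ≥0∞) (ha : a ≠ ∞)
    (h : ∀ t, 2 ≤ t → a ≤ ∫⁻ s, ENNReal.ofReal (c (queue lam μ s t)) ∂(successLaw ε)) :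
    a ≤ longRunAverage ε lam μ c := by
  have hlim : Tendsto (fun T : ℕ => a - a * 2 / (T : ℝ≥0∞)) atTop (𝓝 a) := by
    have h0 : Tendsto (fun T : ℕ => a * 2 / (T : ℝ≥0∞)) atTop (𝓝 0) := by
      have := ENNReal.Tendsto.const_div (a := a * 2) ENNReal.tendsto_nat_nhds_top
        (Or.inr (by finiteness))
      simpa using this
    simpa using ENNReal.Tendsto.sub tendsto_const_nhds h0 (Or.inl ha)
  rw [← hlim.limsup_eq]
  refine limsup_le_limsup ?_
  filter_upwards [eventually_ge_atTop 2] with T hT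
  have hT0 : (T : ℝ≥0∞) ≠ 0 := by simp; omega
  rw [ENNReal.le_div_iff_mul_le (Or.inl hT0) (Or.inl (by simp)), ENNReal.sub_mul (by finiteness),
    ENNReal.div_mul_cancel hT0 (by simp), tsub_le_iff_right]
  obtain ⟨n, rfl⟩ := Nat.exists_eq_add_of_le hT
  rw [Finset.sum_range_add]
  calc a * ((2 + n : ℕ) : ℝ≥0∞) = ∑ i ∈ Finset.range n, a + a * 2 := by
        simp; ring
    _ ≤ _ := by
        gcongr with i hi
        exact le_add_left (Finset.sum_le_sum fun i _ => h (2 + i) (by omega))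

lemma longRunAverage_le (ε : unitInterval) (lam : ℝ) (μ c : ℝ → ℝ) (a : ℝ≥0∞)
    (h : ∀ t, ∫⁻ s, ENNReal.ofReal (c (queue lam μ s t)) ∂(successLaw ε) ≤ a) :
    longRunAverage ε lam μ c ≤ a := by
  refine limsup_le_of_le (by isBoundedDefault) ?_
  filter_upwards [eventually_ge_atTop 1] with T hT
  refine ENNReal.div_le_of_le_mul ?_
  calc _ ≤ ∑ _t ∈ Finset.range T, a := Finset.sum_le_sum fun t _ => h t
    _ = a * T := by simp [mul_comm]

/-- Every control has latency at least `1 + ε`: at least one frame's arrivals are always waiting,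
and after a failure the arrivals of two frames are. -/
lemma one_add_le_latency (ε : unitInterval) {lam : ℝ} (hlam : 0 < lam) (μ : ℝ → ℝ) :
    1 + ENNReal.ofReal ε ≤ latency ε lam μ := by
  refine le_longRunAverage ε lam μ _ _ (by finiteness) fun t ht => ?_
  obtain ⟨t, rfl⟩ := Nat.exists_eq_add_of_le' ht
  rw [show t + 2 = (t + 1) + 1 from rfl,
    lintegral_queue_succ ε lam μ (fun q => ENNReal.ofReal (q / lam))]
  calc 1 + ENNReal.ofReal ε = ENNReal.ofReal ε * 2 + ENNReal.ofReal (1 - ε) * 1 := by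
        nth_rewrite 1 [← ofReal_add_ofReal_one_sub ε]
        ring
    _ = ENNReal.ofReal ε * ∫⁻ _, 2 ∂(successLaw ε) +
        ENNReal.ofReal (1 - ε) * ∫⁻ _, 1 ∂(successLaw ε) := by simp
    _ ≤ _ := by
        gcongr with s s
        · have : (2 : ℝ≥0∞) = ENNReal.ofReal 2 := by simp
          rw [this]
          refine ENNReal.ofReal_le_ofReal ((le_div_iff₀ hlam).2 (le_max_of_le_left ?_))
          linarith [arrival_le_queue lam μ s (t := t + 1) (by omega)]
        · rw [← ENNReal.ofReal_one]
          exact ENNReal.ofReal_le_ofReal ((le_div_iff₀ hlam).2 (by simp))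

/-- If the Cesàro averages of `u` are bounded, then `u T ≤ δ T` for infinitely many `T`. -/
lemma frequently_le_mul_of_limsup_average_ne_top (u : ℕ → ℝ≥0∞)
    (hu : limsup (fun T : ℕ => (∑ t ∈ Finset.range T, u t) / (T : ℝ≥0∞)) atTop ≠ ∞)
    {δ : ℝ≥0∞} (hδ : δ ≠ 0) : ∃ᶠ T : ℕ in atTop, u T ≤ δ * T := by
  intro hev
  obtain ⟨b, hb1, hb2⟩ := ENNReal.lt_iff_exists_nnreal_btwn.1 (lt_top_iff_ne_top.2 hu)
  have hb := eventually_lt_of_limsup_lt hb1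
  have hD : Tendsto (fun T : ℕ => δ * (T : ℝ≥0∞)) atTop (𝓝 ∞) := by
    have := ENNReal.Tendsto.const_mul (a := δ) ENNReal.tendsto_nat_nhds_top (Or.inl (by simp))
    rwa [ENNReal.mul_top hδ] at this
  have hbig : ∀ᶠ T : ℕ in atTop, (2 * b : ℝ≥0∞) < δ * T :=
    hD.eventually (lt_mem_nhds (by finiteness))
  obtain ⟨T₀, hT₀⟩ := eventually_atTop.1 (hb.and (hbig.and hev))
  have h1 := (hT₀ (2 * T₀ + 2) (by omega)).1
  refine absurd h1 (not_lt.2 ?_)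
  rw [ENNReal.le_div_iff_mul_le (Or.inl (by simp)) (Or.inl (by finiteness))]
  calc (b : ℝ≥0∞) * ((2 * T₀ + 2 : ℕ) : ℝ≥0∞) = ∑ i ∈ Finset.range (T₀ + 1), (2 * b : ℝ≥0∞) := by
        simp; ring
    _ ≤ ∑ i ∈ Finset.range (T₀ + 1), u (T₀ + 1 + i) := by
        refine Finset.sum_le_sum fun i _ => ?_
        have h2 := (hT₀ (T₀ + 1 + i) (by omega)).2
        exact h2.1.le.trans (not_le.1 h2.2).le
    _ ≤ _ := by
        rw [show 2 * T₀ + 2 = (T₀ + 1) + (T₀ + 1) by omega, Finset.sum_range_add _ (T₀ + 1)]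
        exact le_add_self

/-- If the latency is finite, the power needed on average is at least the power needed to send `lam`
packets in every frame: the queue is stable, so on average at least `lam` packets are sent, and the
exponential lies above its tangent at `lam`. -/
lemma le_longRunAverage_exp (ε : unitInterval) {lam : ℝ} (hlam : 0 < lam) {μ : ℝ → ℝ}
    (hμ : ∀ q, 0 ≤ q → 0 ≤ μ q) (hfin : latency ε lam μ ≠ ∞) {A b : ℝ} (hA : 0 < A)
    (hb : 0 < b) :
    ENNReal.ofReal (A * Real.exp (lam * b)) ≤
      longRunAverage ε lam μ fun q => A * Real.exp (μ q * b) := by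
  set c : ℝ := A * Real.exp (lam * b) with hc
  have hc0 : 0 < c := by positivity
  set Q : ℕ → ℝ≥0∞ := fun t => ∫⁻ s, ENNReal.ofReal (queue lam μ s t / lam) ∂(successLaw ε)
    with hQ
  set R : ℕ → ℝ≥0∞ := fun t => ∫⁻ s, ENNReal.ofReal (μ (queue lam μ s t) / lam) ∂(successLaw ε)
    with hR
  set E : ℕ → ℝ≥0∞ := fun t =>
    ∫⁻ s, ENNReal.ofReal (A * Real.exp (μ (queue lam μ s t) * b)) ∂(successLaw ε) with hE
  have hQfin : ∀ t, Q t ≠ ∞ := fun t =>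
    lintegral_comp_queue_ne_top ε lam μ (fun q => q / lam) t
  have hbal : ∀ t, 1 + Q t ≤ Q (t + 1) + R t := by
    intro t
    have : (1 : ℝ≥0∞) = ∫⁻ _, ENNReal.ofReal 1 ∂(successLaw ε) := by simp
    rw [this, hQ, hR, ← lintegral_add_left measurable_const, ← lintegral_add_left
      (measurable_comp_queue (fun q => ENNReal.ofReal (q / lam)) lam μ (t + 1))]
    refine lintegral_mono fun s => ?_
    have hq := queue_nonneg hlam.le μ s t
    have hq' := queue_nonneg hlam.le μ s (t + 1)
    have hm := hμ _ hq
    rw [← ENNReal.ofReal_add (by positivity) (by positivity),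
      ← ENNReal.ofReal_add (by positivity) (by positivity)]
    refine ENNReal.ofReal_le_ofReal ?_
    rw [← add_div, one_add_div hlam.ne']
    refine div_le_div_of_nonneg_right ?_ hlam.le
    rw [queue]
    have : (if s t = true then μ (queue lam μ s t) else 0) ≤ μ (queue lam μ s t) := by
      split_ifs <;> simp [hm]
    linarith [le_max_left (queue lam μ s t + lam -
      if s t = true then μ (queue lam μ s t) else 0) lam]
  have hsum : ∀ T : ℕ, (T : ℝ≥0∞) ≤ Q T + ∑ t ∈ Finset.range T, R t := by
    intro T
    suffices h : (T : ℝ≥0∞) + Q 0 ≤ Q T + ∑ t ∈ Finset.range T, R t from le_self_add.trans h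
    induction T with
    | zero => simp
    | succ T ih =>
      have h1 := add_le_add ih (hbal T)
      rw [Finset.sum_range_succ]
      refine (ENNReal.add_le_add_iff_left (hQfin T)).1 ?_
      push_cast
      calc _ = (T : ℝ≥0∞) + Q 0 + (1 + Q T) := by ring
        _ ≤ _ := h1
        _ = _ := by ring
  have htan : ∀ t, ENNReal.ofReal c + ENNReal.ofReal (c * (lam * b)) * R t ≤
      E t + ENNReal.ofReal (c * (lam * b)) := by
    intro t
    have h1 : ENNReal.ofReal c = ∫⁻ _, ENNReal.ofReal c ∂(successLaw ε) := by simp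
    have h2 : ENNReal.ofReal (c * (lam * b)) =
      ∫⁻ _, ENNReal.ofReal (c * (lam * b)) ∂(successLaw ε) := by simp
    rw [hR, ← lintegral_const_mul _
      (measurable_comp_queue (fun q => ENNReal.ofReal (μ q / lam)) lam μ t), h1, h2, hE,
      ← lintegral_add_left measurable_const, ← lintegral_add_right _ measurable_const]
    refine lintegral_mono fun s => ?_
    have hm := hμ _ (queue_nonneg hlam.le μ s t)
    simp only [lintegral_const, measure_univ, mul_one]
    rw [← ENNReal.ofReal_mul (by positivity), ← ENNReal.ofReal_add (by positivity) (by positivity),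
      ← ENNReal.ofReal_add (by positivity) (by positivity)]
    refine ENNReal.ofReal_le_ofReal ?_
    have h3 := Real.add_one_le_exp (μ (queue lam μ s t) * b - lam * b)
    have h4 : A * Real.exp (μ (queue lam μ s t) * b) =
        c * Real.exp (μ (queue lam μ s t) * b - lam * b) := by
      rw [hc, mul_assoc, ← Real.exp_add]; congr 2; ring
    have h5 : c * (lam * b) * (μ (queue lam μ s t) / lam) = c * (μ (queue lam μ s t) * b) := by
      field_simp
    rw [h4, h5]
    nlinarith [mul_le_mul_of_nonneg_left h3 hc0.le]
  set B := ENNReal.ofReal (c * (lam * b)) with hB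
  have hBfin : B ≠ ∞ := ENNReal.ofReal_ne_top
  have hmain : ∀ T : ℕ, ENNReal.ofReal c * T ≤ ∑ t ∈ Finset.range T, E t + B * Q T := by
    intro T
    have h1 : ENNReal.ofReal c * T + B * ∑ t ∈ Finset.range T, R t ≤
        ∑ t ∈ Finset.range T, E t + B * T := by
      have := Finset.sum_le_sum fun t (_ : t ∈ Finset.range T) => htan t
      rw [Finset.sum_add_distrib, Finset.sum_add_distrib, ← Finset.mul_sum] at this
      simpa [mul_comm] using this
    refine (ENNReal.add_le_add_iff_left
      (a := B * T) (ENNReal.mul_ne_top hBfin (by simp))).1 ?_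
    calc B * T + ENNReal.ofReal c * T
        ≤ B * (Q T + ∑ t ∈ Finset.range T, R t) + ENNReal.ofReal c * T := by
          gcongr; exact hsum T
      _ = B * Q T + (ENNReal.ofReal c * T + B * ∑ t ∈ Finset.range T, R t) := by ring
      _ ≤ B * Q T + (∑ t ∈ Finset.range T, E t + B * T) := by gcongr
      _ = _ := by ring
  refine ENNReal.le_of_forall_pos_le_add fun δ hδ _ => ?_
  have hB0 : B ≠ 0 := by rw [hB]; simp; positivity
  have hfreq := frequently_le_mul_of_limsup_average_ne_top Q hfin (δ := δ / B)
    (ENNReal.div_ne_zero.2 ⟨by simpa using hδ.ne', hBfin⟩)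
  have hle : ENNReal.ofReal c - δ ≤ longRunAverage ε lam μ fun q => A * Real.exp (μ q * b) := by
    refine le_limsup_of_frequently_le ?_ (by isBoundedDefault)
    refine (hfreq.and_eventually (eventually_ge_atTop 1)).mono fun T hT => ?_
    have hT0 : (T : ℝ≥0∞) ≠ 0 := by simp; omega
    rw [ENNReal.le_div_iff_mul_le (Or.inl hT0) (Or.inl (by simp)), ENNReal.sub_mul (by finiteness),
      tsub_le_iff_right]
    refine (hmain T).trans (add_le_add le_rfl ?_)
    calc B * Q T ≤ B * (δ / B * T) := by gcongr; exact hT.1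
      _ = δ * T := by rw [← mul_assoc, ENNReal.mul_div_cancel hB0 hBfin]
  exact tsub_le_iff_right.1 hle

end Queue

/-! ### Domination of product measures and of scaled Gaussian laws -/

section Domination

open scoped NNReal

section Pi

variable {ι : Type*} [Fintype ι] {X : ι → Type*} [∀ i, MeasurableSpace (X i)]

lemma measure_pi_mono {μ ν : ∀ i, Measure (X i)} [∀ i, SigmaFinite (μ i)] [∀ i, SigmaFinite (ν i)]
    (h : ∀ i, μ i ≤ ν i) : Measure.pi μ ≤ Measure.pi ν := by
  refine Measure.le_iff.2 fun s hs => ?_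
  rw [Measure.pi, Measure.pi, toMeasure_apply _ _ hs, toMeasure_apply _ _ hs]
  refine (OuterMeasure.le_pi.2 fun t _ => ?_) s
  exact (OuterMeasure.pi_pi_le _ _).trans (Finset.prod_le_prod' fun i _ => h i _)

lemma measure_pi_smul (μ : ∀ i, Measure (X i)) [∀ i, SigmaFinite (μ i)] (C : ι → ℝ≥0) :
    Measure.pi (fun i => C i • μ i) = (∏ i, C i) • Measure.pi μ := by
  refine Measure.pi_eq fun s _ => ?_
  simp only [Measure.smul_apply, Measure.pi_pi, ENNReal.smul_def, smul_eq_mul,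
    Finset.prod_mul_distrib]
  push_cast
  rfl

lemma measure_pi_le_smul {μ ν : ∀ i, Measure (X i)} [∀ i, SigmaFinite (μ i)]
    [∀ i, SigmaFinite (ν i)] {C : ι → ℝ≥0} (h : ∀ i, μ i ≤ C i • ν i) :
    Measure.pi μ ≤ (∏ i, C i) • Measure.pi ν :=
  (measure_pi_mono h).trans (measure_pi_smul ν C).le

/-- If coordinatewise maps distort the factors of a product of probability measures at most by
constants, they distort the product at most by the product of the constants. -/
lemma map_measure_pi_le_smul {μ : ∀ i, Measure (X i)} [∀ i, IsProbabilityMeasure (μ i)]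
    {f : ∀ i, X i → X i} (hf : ∀ i, Measurable (f i)) {C : ι → ℝ≥0}
    (h : ∀ i, (μ i).map (f i) ≤ C i • μ i) :
    (Measure.pi μ).map (fun x i => f i (x i)) ≤ (∏ i, C i) • Measure.pi μ := by
  have : ∀ i, IsProbabilityMeasure ((μ i).map (f i)) := fun i =>
    Measure.isProbabilityMeasure_map (hf i).aemeasurable
  rw [Measure.pi_map_pi fun i => (hf i).aemeasurable]
  exact measure_pi_le_smul h

end Pi

lemma gaussianReal_map_inv_mul_le {v : ℝ≥0} (hv : v ≠ 0) {s : ℝ≥0} (hs : 1 ≤ s) :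
    (gaussianReal 0 v).map (fun x => (s : ℝ)⁻¹ * x) ≤ s • gaussianReal 0 v := by
  have hs0 : 0 < (s : ℝ) := lt_of_lt_of_le one_pos hs
  have hw : (NNReal.mk (((s : ℝ)⁻¹) ^ 2) (sq_nonneg _) * v : ℝ≥0) ≠ 0 := by
    rw [← NNReal.coe_ne_zero]
    have : (v : ℝ) ≠ 0 := by exact_mod_cast hv
    simp [this, hs0.ne']
  rw [gaussianReal_map_const_mul, mul_zero, gaussianReal_of_var_ne_zero _ hw,
    gaussianReal_of_var_ne_zero _ hv]
  change _ ≤ (s : ℝ≥0∞) • (volume.withDensity (gaussianPDF 0 v) : Measure ℝ)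
  rw [← withDensity_smul' _ _ (by simp)]
  refine withDensity_mono (ae_of_all _ fun x => ?_)
  have hv0 : 0 < (v : ℝ) := lt_of_le_of_ne v.2 (by exact_mod_cast hv.symm)
  rw [Pi.smul_apply, smul_eq_mul, gaussianPDF, gaussianPDF,
    ← ENNReal.ofReal_coe_nnreal, ← ENNReal.ofReal_mul hs0.le]
  refine ENNReal.ofReal_le_ofReal ?_
  simp only [gaussianPDFReal, NNReal.coe_mul, NNReal.coe_mk, sub_zero]
  have h1 : √(2 * Real.pi * (((s : ℝ)⁻¹) ^ 2 * v)) = (s : ℝ)⁻¹ * √(2 * Real.pi * v) := by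
    rw [show 2 * Real.pi * (((s : ℝ)⁻¹) ^ 2 * v) = ((s : ℝ)⁻¹) ^ 2 * (2 * Real.pi * v) by ring,
      Real.sqrt_mul (sq_nonneg _), Real.sqrt_sq (inv_nonneg.2 hs0.le)]
  rw [h1, mul_inv, inv_inv, mul_assoc]
  refine mul_le_mul_of_nonneg_left (mul_le_mul_of_nonneg_left (Real.exp_le_exp.2 ?_)
    (by positivity)) hs0.le
  rw [neg_div, neg_div, neg_le_neg_iff]
  refine div_le_div_of_nonneg_left (sq_nonneg _) (by positivity) ?_
  have h3 : ((s : ℝ)⁻¹) ^ 2 ≤ 1 := pow_le_one₀ (inv_nonneg.2 hs0.le) (inv_le_one_of_one_le₀ hs)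
  nlinarith

lemma gaussianReal_le_smul_volume {v : ℝ≥0} (hv : v ≠ 0) :
    ∃ C : ℝ≥0, gaussianReal 0 v ≤ C • volume := by
  refine ⟨((√(2 * Real.pi * v))⁻¹).toNNReal, ?_⟩
  rw [gaussianReal_of_var_ne_zero _ hv]
  change _ ≤ ENNReal.ofReal (√(2 * Real.pi * v))⁻¹ • (volume : Measure ℝ)
  rw [← withDensity_const]
  refine withDensity_mono (ae_of_all _ fun x => ?_)
  refine ENNReal.ofReal_le_ofReal ?_
  simp only [gaussianPDFReal]
  refine mul_le_of_le_one_right (by positivity) (Real.exp_le_one_iff.2 ?_)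
  rw [neg_div]
  exact neg_nonpos.2 (by positivity)

/-- Shrinking a complex Gaussian variable by a factor `s ≥ 1` increases its density at most by the
factor `s ^ 2`. -/
lemma complexGaussian_map_inv_smul_le {v : ℝ} (hv : 0 < v) {s : ℝ≥0} (hs : 1 ≤ s) :
    (complexGaussian v).map (fun z => ((s : ℝ)⁻¹ : ℝ) • z) ≤ s ^ 2 • complexGaussian v := by
  have hv' : (v / 2).toNNReal ≠ 0 := by simpa using hv
  have h1 := gaussianReal_map_inv_mul_le hv' hs
  have hm : Measurable fun x : ℝ => (s : ℝ)⁻¹ * x := by fun_prop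
  have h2 := Measure.prod_mono h1 h1
  rw [Measure.map_prod_map _ _ hm hm] at h2
  have h3 : (s • gaussianReal 0 (v / 2).toNNReal).prod (s • gaussianReal 0 (v / 2).toNNReal) =
      s ^ 2 • (gaussianReal 0 (v / 2).toNNReal).prod (gaussianReal 0 (v / 2).toNNReal) := by
    rw [Measure.prod_smul_left, Measure.prod_smul_right, smul_smul, sq]
  rw [h3] at h2
  have h4 := Measure.map_mono h2 Complex.measurableEquivRealProd.symm.measurable
  rw [complexGaussian, Measure.map_map (by fun_prop)
    Complex.measurableEquivRealProd.symm.measurable, ← Measure.map_smul]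
  rw [Measure.map_map Complex.measurableEquivRealProd.symm.measurable (by fun_prop)] at h4
  convert h4 using 2
  funext z
  apply Complex.ext <;> simp [Complex.measurableEquivRealProd]

lemma complexGaussian_le_smul_volume {v : ℝ} (hv : 0 < v) :
    ∃ C : ℝ≥0, complexGaussian v ≤ C • volume := by
  have hv' : (v / 2).toNNReal ≠ 0 := by simpa using hv
  obtain ⟨C, hC⟩ := gaussianReal_le_smul_volume hv'
  refine ⟨C * C, ?_⟩
  have h2 := Measure.prod_mono hC hC
  rw [Measure.prod_smul_left, Measure.prod_smul_right, smul_smul] at h2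
  have h4 := Measure.map_mono h2 Complex.measurableEquivRealProd.symm.measurable
  rw [Measure.map_smul] at h4
  rwa [← Measure.volume_eq_prod,
    (Complex.volume_preserving_equiv_real_prod.symm Complex.measurableEquivRealProd).map_eq] at h4

end Domination

/-! ### The zero-forcing gain of a user -/

section ZeroForcing

variable {K : ℕ}

/-- The zero-forcing gain `1 / [(Hᴴ H)⁻¹]_{kk}`, the squared distance of column `k` of `H` from the
span of the other columns; it is zero when the columns are linearly dependent. -/
def zfGain {M : ℕ} (H : Fin M → Fin K → ℂ) (k : Fin K) : ℝ := (invGramDiag H k)⁻¹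

/-- The squared Euclidean norm of `H a`. -/
def normSqMulVec {M : ℕ} (H : Fin M → Fin K → ℂ) (a : Fin K → ℂ) : ℝ :=
  ∑ i, ‖(Matrix.of H *ᵥ a) i‖ ^ 2

lemma normSqMulVec_nonneg {M : ℕ} (H : Fin M → Fin K → ℂ) (a : Fin K → ℂ) :
    0 ≤ normSqMulVec H a := Finset.sum_nonneg fun _ _ => sq_nonneg _

lemma normSqMulVec_append {m n : ℕ} (H₁ : Fin m → Fin K → ℂ) (H₂ : Fin n → Fin K → ℂ)
    (a : Fin K → ℂ) :
    normSqMulVec (Fin.append H₁ H₂) a = normSqMulVec H₁ a + normSqMulVec H₂ a := by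
  simp [normSqMulVec, Fin.sum_univ_add, Matrix.mulVec, dotProduct]

/-- Cauchy--Schwarz for the sesquilinear form of the Gram matrix. -/
lemma norm_dotProduct_gram_sq_le {M : ℕ} (H : Fin M → Fin K → ℂ) (a y : Fin K → ℂ) :
    ‖star a ⬝ᵥ (((Matrix.of H)ᴴ * Matrix.of H) *ᵥ y)‖ ^ 2 ≤
      normSqMulVec H a * normSqMulVec H y := by
  have h : star a ⬝ᵥ (((Matrix.of H)ᴴ * Matrix.of H) *ᵥ y) =
      star (Matrix.of H *ᵥ a) ⬝ᵥ (Matrix.of H *ᵥ y) := by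
    rw [← Matrix.mulVec_mulVec, Matrix.dotProduct_mulVec, Matrix.star_mulVec]
  rw [h]
  calc _ ≤ (∑ i, ‖(Matrix.of H *ᵥ a) i‖ * ‖(Matrix.of H *ᵥ y) i‖) ^ 2 := by
        gcongr
        refine (norm_sum_le _ _).trans (le_of_eq (Finset.sum_congr rfl fun i _ => ?_))
        simp
    _ ≤ _ := Finset.sum_mul_sq_le_sq_mul_sq _ _ _

lemma dotProduct_gram_self {M : ℕ} (H : Fin M → Fin K → ℂ) (y : Fin K → ℂ) :
    star y ⬝ᵥ (((Matrix.of H)ᴴ * Matrix.of H) *ᵥ y) = (normSqMulVec H y : ℂ) := by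
  rw [← Matrix.mulVec_mulVec, Matrix.dotProduct_mulVec, ← Matrix.star_mulVec, normSqMulVec]
  push_cast
  refine Finset.sum_congr rfl fun i _ => ?_
  simp [← Complex.conj_mul']

lemma zfGain_of_not_isUnit {M : ℕ} {H : Fin M → Fin K → ℂ} {k : Fin K}
    (h : ¬IsUnit ((Matrix.of H)ᴴ * Matrix.of H).det) : zfGain H k = 0 := by
  simp [zfGain, invGramDiag, Matrix.nonsing_inv_apply_not_isUnit _ h]

/-- Column `k` of the inverse Gram matrix. -/
lemma exists_gram_mulVec_eq_single {M : ℕ} {H : Fin M → Fin K → ℂ} (k : Fin K)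
    (h : IsUnit ((Matrix.of H)ᴴ * Matrix.of H).det) :
    ∃ y : Fin K → ℂ, ((Matrix.of H)ᴴ * Matrix.of H) *ᵥ y = Pi.single k 1 ∧
      y k = (normSqMulVec H y : ℂ) ∧ invGramDiag H k = normSqMulVec H y ∧
      0 < normSqMulVec H y := by
  set G := (Matrix.of H)ᴴ * Matrix.of H with hG
  set y : Fin K → ℂ := G⁻¹ *ᵥ Pi.single k 1 with hy
  have h1 : G *ᵥ y = Pi.single k 1 := by
    rw [hy, Matrix.mulVec_mulVec, Matrix.mul_nonsing_inv _ h, Matrix.one_mulVec]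
  have h2 : y k = G⁻¹ k k := by simp [hy]
  have h3 : star (y k) = (normSqMulVec H y : ℂ) := by
    rw [← dotProduct_gram_self, ← hG, h1]
    simp
  have h4 : y k = (normSqMulVec H y : ℂ) := by
    rw [← star_star (y k), h3]
    simp
  refine ⟨y, h1, h4, ?_, ?_⟩
  · rw [invGramDiag, ← hG, ← h2, h4, Complex.ofReal_re]
  · refine lt_of_le_of_ne (normSqMulVec_nonneg H y) fun h0 => ?_
    have h5 := norm_dotProduct_gram_sq_le H (Pi.single k 1) y
    rw [← h0, ← hG, h1] at h5
    simp at h5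
    norm_num at h5

lemma zfGain_pos {M : ℕ} {H : Fin M → Fin K → ℂ} {k : Fin K}
    (h : IsUnit ((Matrix.of H)ᴴ * Matrix.of H).det) : 0 < zfGain H k := by
  obtain ⟨y, -, -, h1, h2⟩ := exists_gram_mulVec_eq_single k h
  rw [zfGain, h1]
  exact inv_pos.2 h2

lemma zfGain_nonneg {M : ℕ} (H : Fin M → Fin K → ℂ) (k : Fin K) : 0 ≤ zfGain H k := by
  by_cases h : IsUnit ((Matrix.of H)ᴴ * Matrix.of H).det
  · exact (zfGain_pos h).le
  · exact (zfGain_of_not_isUnit h).ge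

lemma zfGain_le_normSqMulVec {M : ℕ} (H : Fin M → Fin K → ℂ) {k : Fin K} {a : Fin K → ℂ}
    (ha : a k = 1) : zfGain H k ≤ normSqMulVec H a := by
  by_cases h : IsUnit ((Matrix.of H)ᴴ * Matrix.of H).det
  · obtain ⟨y, h1, -, h2, h3⟩ := exists_gram_mulVec_eq_single k h
    have h4 := norm_dotProduct_gram_sq_le H a y
    rw [h1] at h4
    rw [zfGain, h2, inv_le_iff_one_le_mul₀ h3]
    simpa [ha] using h4
  · rw [zfGain_of_not_isUnit h]
    exact normSqMulVec_nonneg H a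

/-- The minimum in `zfGain_le_normSqMulVec` is attained. -/
lemma exists_normSqMulVec_eq_zfGain {M : ℕ} {H : Fin M → Fin K → ℂ} {k : Fin K}
    (h : IsUnit ((Matrix.of H)ᴴ * Matrix.of H).det) :
    ∃ a : Fin K → ℂ, a k = 1 ∧ normSqMulVec H a = zfGain H k := by
  obtain ⟨y, -, h1, h2, h3⟩ := exists_gram_mulVec_eq_single k h
  have h3' : (normSqMulVec H y : ℂ) ≠ 0 := by exact_mod_cast h3.ne'
  refine ⟨(normSqMulVec H y : ℂ)⁻¹ • y, by simp [h1, h3'], ?_⟩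
  have h4 : normSqMulVec H ((normSqMulVec H y : ℂ)⁻¹ • y) =
      (normSqMulVec H y)⁻¹ ^ 2 * normSqMulVec H y := by
    conv_lhs => rw [normSqMulVec]
    conv_rhs => rw [normSqMulVec, Finset.mul_sum]
    refine Finset.sum_congr rfl fun i _ => ?_
    rw [Matrix.mulVec_smul, Pi.smul_apply, norm_smul, mul_pow, norm_inv, Complex.norm_real,
      Real.norm_of_nonneg h3.le]
    rfl
  rw [h4, zfGain, h2]
  field_simp

lemma isUnit_det_gram_iff {M : ℕ} (H : Fin M → Fin K → ℂ) :
    IsUnit ((Matrix.of H)ᴴ * Matrix.of H).det ↔ ∀ a, normSqMulVec H a = 0 → a = 0 := by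
  rw [isUnit_iff_ne_zero, Ne, ← Matrix.exists_mulVec_eq_zero_iff]
  push Not
  refine forall_congr' fun a => ?_
  have h : ((Matrix.of H)ᴴ * Matrix.of H) *ᵥ a = 0 ↔ normSqMulVec H a = 0 := by
    refine ⟨fun h => ?_, fun h => ?_⟩
    · have h1 := dotProduct_gram_self H a
      rw [h, dotProduct_zero] at h1
      exact_mod_cast h1.symm
    · rw [normSqMulVec, Finset.sum_eq_zero_iff_of_nonneg fun _ _ => sq_nonneg _] at h
      have h1 : Matrix.of H *ᵥ a = 0 := funext fun i => by simpa using h i (Finset.mem_univ i)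
      rw [← Matrix.mulVec_mulVec, h1, Matrix.mulVec_zero]
  rw [← h]
  tauto

/-- Stacking antennas adds at least the zero-forcing gains of the parts, because the gain is the
minimum of `‖H a‖ ^ 2` over the vectors with `a k = 1`. -/
lemma add_zfGain_le_zfGain_append {m n : ℕ} (H₁ : Fin m → Fin K → ℂ) (H₂ : Fin n → Fin K → ℂ)
    (k : Fin K) : zfGain H₁ k + zfGain H₂ k ≤ zfGain (Fin.append H₁ H₂) k := by
  by_cases h : IsUnit ((Matrix.of (Fin.append H₁ H₂))ᴴ * Matrix.of (Fin.append H₁ H₂)).det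
  · obtain ⟨a, ha, ha'⟩ := exists_normSqMulVec_eq_zfGain (k := k) h
    rw [← ha', normSqMulVec_append]
    exact add_le_add (zfGain_le_normSqMulVec H₁ ha) (zfGain_le_normSqMulVec H₂ ha)
  · have h1 : ¬IsUnit ((Matrix.of H₁)ᴴ * Matrix.of H₁).det := fun h1 => h <| by
      rw [isUnit_det_gram_iff] at h1 ⊢
      intro a ha
      rw [normSqMulVec_append] at ha
      exact h1 a (by linarith [normSqMulVec_nonneg H₁ a, normSqMulVec_nonneg H₂ a])
    have h2 : ¬IsUnit ((Matrix.of H₂)ᴴ * Matrix.of H₂).det := fun h2 => h <| by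
      rw [isUnit_det_gram_iff] at h2 ⊢
      intro a ha
      rw [normSqMulVec_append] at ha
      exact h2 a (by linarith [normSqMulVec_nonneg H₁ a, normSqMulVec_nonneg H₂ a])
    rw [zfGain_of_not_isUnit h1, zfGain_of_not_isUnit h2, add_zero]
    exact zfGain_nonneg _ k

lemma zfGain_smul {M : ℕ} (H : Fin M → Fin K → ℂ) (k : Fin K) {c : ℝ} (hc : c ≠ 0) :
    zfGain (c • H) k = c ^ 2 * zfGain H k := by
  have hG : (Matrix.of (c • H))ᴴ * Matrix.of (c • H) =
      ((c : ℂ) ^ 2) • ((Matrix.of H)ᴴ * Matrix.of H) := by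
    have : Matrix.of (c • H) = (c : ℂ) • Matrix.of H := by
      ext i j; simp
    rw [this, Matrix.conjTranspose_smul, Matrix.smul_mul, Matrix.mul_smul, smul_smul]
    simp [sq]
  have hc' : (c : ℂ) ^ 2 ≠ 0 := by exact_mod_cast pow_ne_zero 2 hc
  by_cases h : IsUnit ((Matrix.of H)ᴴ * Matrix.of H).det
  · have : Invertible ((c : ℂ) ^ 2) := invertibleOfNonzero hc'
    rw [zfGain, zfGain, invGramDiag, invGramDiag, hG, Matrix.inv_smul _ _ h]
    have h5 : (⅟((c : ℂ) ^ 2) : ℂ) = ((c ^ 2)⁻¹ : ℝ) := by simp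
    rw [Matrix.smul_apply, h5, smul_eq_mul, Complex.re_ofReal_mul, mul_inv, inv_inv]
  · rw [zfGain_of_not_isUnit h, zfGain_of_not_isUnit, mul_zero]
    rw [hG, Matrix.det_smul]
    intro h6
    exact h (isUnit_of_mul_isUnit_right h6)

@[fun_prop]
lemma measurable_zfGain {M : ℕ} (k : Fin K) :
    Measurable fun H : Fin M → Fin K → ℂ => zfGain H k := by
  have hc : Continuous fun H : Fin M → Fin K → ℂ => (Matrix.of H)ᴴ * Matrix.of H := by
    have : Continuous fun H : Fin M → Fin K → ℂ => Matrix.of H := continuous_id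
    fun_prop
  have h1 : Measurable fun H : Fin M → Fin K → ℂ => ((Matrix.of H)ᴴ * Matrix.of H).det :=
    hc.matrix_det.measurable
  have h2 : Measurable fun H : Fin M → Fin K → ℂ =>
      ((Matrix.of H)ᴴ * Matrix.of H).adjugate k k :=
    (hc.matrix_adjugate.matrix_elem k k).measurable
  simp only [zfGain, invGramDiag, Matrix.inv_def, Matrix.smul_apply, Ring.inverse_eq_inv',
    smul_eq_mul]
  exact (Complex.measurable_re.comp (h1.inv.mul h2)).inv

/-- Singular square matrices form a Lebesgue null set: every line `t ↦ A + t • 1` meets them in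
finitely many points. -/
lemma volume_setOf_det_eq_zero :
    volume {A : Fin K → Fin K → ℂ | (Matrix.of A).det = 0} = 0 := by
  set S := {A : Fin K → Fin K → ℂ | (Matrix.of A).det = 0} with hS
  set U : Fin K → Fin K → ℂ := fun i j => (1 : Matrix (Fin K) (Fin K) ℂ) i j with hU
  have hof : Continuous fun A : Fin K → Fin K → ℂ => Matrix.of A := continuous_id
  have hmS : MeasurableSet S :=
    (isClosed_eq hof.matrix_det continuous_const).measurableSet
  have hline : ∀ A : Fin K → Fin K → ℂ, {t : ℝ | A + t • U ∈ S}.Finite := by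
    intro A
    have hfin : ((-Matrix.of A).charpoly.roots.toFinset : Set ℂ).Finite := Finset.finite_toSet _
    refine (hfin.preimage (f := ((↑) : ℝ → ℂ)) Complex.ofReal_injective.injOn).subset ?_
    intro t ht
    have h1 : Matrix.of (A + t • U) = Matrix.scalar (Fin K) (t : ℂ) - -Matrix.of A := by
      ext i j
      simp [hU, Matrix.one_apply, Matrix.diagonal_apply, add_comm]
    simp only [Set.mem_preimage, Finset.mem_coe, Multiset.mem_toFinset]
    rw [Polynomial.mem_roots (Matrix.charpoly_monic _).ne_zero, Polynomial.IsRoot,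
      Matrix.eval_charpoly, ← h1]
    exact ht
  have h1 : ∀ t : ℝ, ∫⁻ A : Fin K → Fin K → ℂ, S.indicator 1 (A + t • U) = volume S := by
    intro t
    rw [lintegral_add_right_eq_self (S.indicator 1) (t • U), lintegral_indicator_one hmS]
  have h2 : ∀ A : Fin K → Fin K → ℂ,
      ∫⁻ t in Set.Icc (0 : ℝ) 1, S.indicator (1 : (Fin K → Fin K → ℂ) → ℝ≥0∞) (A + t • U) = 0 := by
    intro A
    have h3 : ∫⁻ t in Set.Icc (0 : ℝ) 1, S.indicator (1 : (Fin K → Fin K → ℂ) → ℝ≥0∞) (A + t • U) =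
        ∫⁻ t in Set.Icc (0 : ℝ) 1, {t : ℝ | A + t • U ∈ S}.indicator 1 t := rfl
    rw [h3, lintegral_indicator_one (hline A).measurableSet]
    exact (hline A).measure_zero _
  have h4 : ∫⁻ A : Fin K → Fin K → ℂ,
      ∫⁻ t in Set.Icc (0 : ℝ) 1, S.indicator (1 : (Fin K → Fin K → ℂ) → ℝ≥0∞) (A + t • U) =
      ∫⁻ t in Set.Icc (0 : ℝ) 1, ∫⁻ A : Fin K → Fin K → ℂ, S.indicator 1 (A + t • U) := by
    refine lintegral_lintegral_swap (Measurable.aemeasurable ?_)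
    exact (measurable_one.indicator hmS).comp
      (by fun_prop : Measurable fun p : (Fin K → Fin K → ℂ) × ℝ => p.1 + p.2 • U)
  simp only [h1, h2] at h4
  simpa using h4.symm

end ZeroForcing

/-! ### Lower tail of the zero-forcing gain for independent antennas -/

section Antennas

open scoped NNReal

lemma measurePreserving_append {E : Type*} [MeasurableSpace E] (ν : Measure E)
    [IsProbabilityMeasure ν] (m n : ℕ) :
    MeasurePreserving (fun p : (Fin m → E) × (Fin n → E) => Fin.append p.1 p.2)
      ((Measure.pi fun _ => ν).prod (Measure.pi fun _ => ν)) (Measure.pi fun _ => ν) := by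
  have hm : Measurable fun p : (Fin m → E) × (Fin n → E) => Fin.append p.1 p.2 := by
    refine measurable_pi_iff.2 fun i => ?_
    refine Fin.addCases (fun i => ?_) (fun i => ?_) i
    · simp only [Fin.append_left]; fun_prop
    · simp only [Fin.append_right]; fun_prop
  refine ⟨hm, (Measure.pi_eq fun s hs => ?_).symm⟩
  rw [Measure.map_apply hm (MeasurableSet.univ_pi hs), Fin.prod_univ_add, ← Measure.pi_pi,
    ← Measure.pi_pi, ← Measure.prod_prod]
  congr 1
  ext p
  simp only [Set.mem_preimage, Set.mem_pi, Set.mem_univ, true_imp_iff, Set.mem_prod]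
  refine ⟨fun h => ⟨fun i => ?_, fun i => ?_⟩, fun h i => ?_⟩
  · simpa using h (Fin.castAdd n i)
  · simpa using h (Fin.natAdd m i)
  · refine Fin.addCases (fun i => ?_) (fun i => ?_) i
    · simpa using h.1 i
    · simpa using h.2 i

variable {K : ℕ} (ν : Measure (Fin K → ℂ)) [IsProbabilityMeasure ν] (k : Fin K)

lemma ae_zfGain_pos {C : ℝ≥0} (hν : ν ≤ C • volume) {M : ℕ} (hM : K ≤ M) :
    ∀ᵐ H ∂(Measure.pi fun _ : Fin M => ν), 0 < zfGain H k := by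
  have hsq : ∀ᵐ H ∂(Measure.pi fun _ : Fin K => ν), 0 < zfGain H k := by
    have h1 : Measure.pi (fun _ : Fin K => ν) {A | (Matrix.of A).det = 0} = 0 := by
      have h2 := measure_pi_le_smul (fun _ : Fin K => hν) {A | (Matrix.of A).det = 0}
      have h3 : Measure.pi (fun _ : Fin K => (volume : Measure (Fin K → ℂ)))
        {A | (Matrix.of A).det = 0} = 0 := volume_setOf_det_eq_zero
      simpa [h3] using h2
    refine measure_mono_null (fun H hH => ?_) h1
    simp only [Set.mem_compl_iff, Set.mem_ofPred_eq] at hH ⊢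
    by_contra hdet
    refine hH (zfGain_pos ?_)
    rw [isUnit_iff_ne_zero, Matrix.det_mul, Matrix.det_conjTranspose]
    exact mul_ne_zero (star_ne_zero.2 hdet) hdet
  obtain ⟨n, rfl⟩ := Nat.exists_eq_add_of_le hM
  rw [← (measurePreserving_append ν K n).map_eq, ae_map_iff
    (measurePreserving_append ν K n).measurable.aemeasurable
    (measurableSet_lt measurable_const (measurable_zfGain k))]
  filter_upwards [Measure.quasiMeasurePreserving_fst.ae hsq] with p hp
  linarith [add_zfGain_le_zfGain_append p.1 p.2 k, zfGain_nonneg p.2 k]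

/-- The Laplace transform of the zero-forcing gain of user `k` when the rows of the `M × K` channel
matrix are independent with law `ν`. -/
def zfLaplace (θ : ℝ) (M : ℕ) : ℝ≥0∞ :=
  ∫⁻ H, ENNReal.ofReal (Real.exp (-(θ * zfGain H k))) ∂(Measure.pi fun _ : Fin M => ν)

lemma zfLaplace_add_le {θ : ℝ} (hθ : 0 ≤ θ) (m n : ℕ) :
    zfLaplace ν k θ (m + n) ≤ zfLaplace ν k θ m * zfLaplace ν k θ n := by
  have hm : ∀ n : ℕ, Measurable fun H : Fin n → Fin K → ℂ =>
    ENNReal.ofReal (Real.exp (-(θ * zfGain H k))) := fun n => by fun_prop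
  rw [zfLaplace, ← (measurePreserving_append ν m n).lintegral_comp (hm _), zfLaplace, zfLaplace,
    ← lintegral_prod_mul (hm m).aemeasurable (hm n).aemeasurable]
  refine lintegral_mono fun p => ?_
  rw [← ENNReal.ofReal_mul (Real.exp_pos _).le, ← Real.exp_add]
  refine ENNReal.ofReal_le_ofReal (Real.exp_le_exp.2 ?_)
  nlinarith [add_zfGain_le_zfGain_append p.1 p.2 k]

lemma zfLaplace_le_one {θ : ℝ} (hθ : 0 ≤ θ) (M : ℕ) : zfLaplace ν k θ M ≤ 1 := by
  calc zfLaplace ν k θ M ≤ ∫⁻ _, 1 ∂(Measure.pi fun _ : Fin M => ν) := by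
        refine lintegral_mono fun H => ?_
        rw [← ENNReal.ofReal_one]
        refine ENNReal.ofReal_le_ofReal (Real.exp_le_one_iff.2 ?_)
        have := mul_nonneg hθ (zfGain_nonneg H k)
        linarith
    _ = 1 := by simp

lemma zfLaplace_mul_add_le {θ : ℝ} (hθ : 0 ≤ θ) (B n r : ℕ) :
    zfLaplace ν k θ (B * n + r) ≤ zfLaplace ν k θ n ^ B := by
  induction B with
  | zero => simpa using zfLaplace_le_one ν k hθ r
  | succ B ih =>
    rw [show (B + 1) * n + r = n + (B * n + r) by ring, pow_succ']
    exact (zfLaplace_add_le ν k hθ _ _).trans (mul_le_mul_right ih _)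

/-- The Laplace transform for a square channel vanishes at infinity because the gain is almost
surely positive. -/
lemma exists_zfLaplace_le {C : ℝ≥0} (hν : ν ≤ C • volume) {δ : ℝ≥0∞} (hδ : 0 < δ) :
    ∃ θ : ℝ, 0 < θ ∧ zfLaplace ν k θ K ≤ δ := by
  have hlim : Tendsto (fun n : ℕ => zfLaplace ν k n K) atTop
      (𝓝 (∫⁻ _, 0 ∂(Measure.pi fun _ : Fin K => ν))) := by
    refine tendsto_lintegral_of_dominated_convergence (fun _ => 1) (fun n => by fun_prop)
      (fun n => ae_of_all _ fun H => ?_) (by simp) ?_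
    · rw [← ENNReal.ofReal_one]
      refine ENNReal.ofReal_le_ofReal (Real.exp_le_one_iff.2 ?_)
      have := mul_nonneg n.cast_nonneg (zfGain_nonneg H k)
      linarith
    · filter_upwards [ae_zfGain_pos ν k hν le_rfl] with H hH
      rw [← ENNReal.ofReal_zero]
      refine ENNReal.tendsto_ofReal (Real.tendsto_exp_neg_atTop_nhds_zero.comp ?_)
      exact tendsto_natCast_atTop_atTop.atTop_mul_const hH
  rw [lintegral_zero] at hlim
  obtain ⟨n, hn1, hn2⟩ := ((hlim.eventually (gt_mem_nhds hδ)).and (eventually_gt_atTop 0)).exists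
  exact ⟨n, by exact_mod_cast hn2, hn1.le⟩

/-- A Chernoff bound: as the number `M` of antennas grows, the gain per antenna stays above some
fixed level except on an event of exponentially small probability. -/
lemma exists_measure_zfGain_le {C : ℝ≥0} (hν : ν ≤ C • volume) :
    ∃ x : ℝ, 0 < x ∧ ∀ M : ℕ, Measure.pi (fun _ : Fin M => ν) {H | zfGain H k ≤ x * M} ≤
      ENNReal.ofReal (Real.exp (2 * K) * Real.exp (-M)) := by
  -- a factor `exp (-2 K)` per block of `K` antennas outweighs the factor `exp M` of Markov's
  -- inequality
  obtain ⟨θ, hθ, hL⟩ := exists_zfLaplace_le ν k hν (δ := ENNReal.ofReal (Real.exp (-(2 * K))))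
    (by positivity)
  refine ⟨θ⁻¹, inv_pos.2 hθ, fun M => ?_⟩
  have hK : 0 < K := k.pos
  have hLM : zfLaplace ν k θ M ≤ ENNReal.ofReal (Real.exp (2 * K - 2 * M)) := by
    have h1 := zfLaplace_mul_add_le ν k hθ.le (M / K) K (M % K)
    rw [Nat.div_add_mod'] at h1
    refine h1.trans ((pow_le_pow_left' hL _).trans ?_)
    rw [← ENNReal.ofReal_pow (Real.exp_pos _).le, ← Real.exp_nat_mul]
    refine ENNReal.ofReal_le_ofReal (Real.exp_le_exp.2 ?_)
    have h2 : (M : ℝ) ≤ (M / K : ℕ) * K + K := by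
      have := Nat.div_add_mod' M K
      have := Nat.mod_lt M hK
      exact_mod_cast (by omega : M ≤ M / K * K + K)
    linarith
  calc Measure.pi (fun _ : Fin M => ν) {H | zfGain H k ≤ θ⁻¹ * M}
      ≤ Measure.pi (fun _ : Fin M => ν)
        {H | 1 ≤ ENNReal.ofReal (Real.exp (M - θ * zfGain H k))} := by
        refine measure_mono fun H hH => ?_
        simp only [Set.mem_ofPred_eq] at hH ⊢
        rw [← ENNReal.ofReal_one]
        refine ENNReal.ofReal_le_ofReal (Real.one_le_exp ?_)
        rw [inv_mul_eq_div, le_div_iff₀ hθ] at hH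
        linarith
    _ ≤ ∫⁻ H, ENNReal.ofReal (Real.exp (M - θ * zfGain H k))
          ∂(Measure.pi fun _ : Fin M => ν) := by
        have := mul_meas_ge_le_lintegral (μ := Measure.pi fun _ : Fin M => ν)
          (f := fun H => ENNReal.ofReal (Real.exp (M - θ * zfGain H k))) (by fun_prop) 1
        rwa [one_mul] at this
    _ = ENNReal.ofReal (Real.exp M) * zfLaplace ν k θ M := by
        rw [zfLaplace, ← lintegral_const_mul _ (by fun_prop)]
        refine lintegral_congr fun H => ?_
        rw [← ENNReal.ofReal_mul (Real.exp_pos _).le, ← Real.exp_add, sub_eq_add_neg]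
    _ ≤ ENNReal.ofReal (Real.exp M) * ENNReal.ofReal (Real.exp (2 * K - 2 * M)) := by gcongr
    _ = _ := by
        rw [← ENNReal.ofReal_mul (Real.exp_pos _).le, ← Real.exp_add, ← Real.exp_add]
        congr 2
        ring

end Antennas

/-! ### The law of the effective channel gain -/

namespace Uplink

open scoped NNReal

variable {K : ℕ} (S : Uplink K)

lemma estVar_pos (k : Fin K) : 0 < S.estVar k := by
  have := mul_pos (mul_pos (S.τ_pos k) (S.pτ_pos k)) (S.γ_pos k)
  unfold estVar
  positivity

/-- The law of one row of the channel estimate, the channel of one antenna. -/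
def rowLaw : Measure (Fin K → ℂ) := Measure.pi fun k => complexGaussian (S.estVar k)

instance : IsProbabilityMeasure S.rowLaw := by unfold rowLaw; infer_instance

lemma channelLaw_eq (M : ℕ) :
    S.channelLaw M = Measure.pi fun _ => Measure.pi fun _ => S.rowLaw := rfl

lemma rowLaw_le_smul_volume : ∃ C : ℝ≥0, S.rowLaw ≤ C • volume := by
  choose C hC using fun k => complexGaussian_le_smul_volume (S.estVar_pos k)
  exact ⟨∏ k, C k, measure_pi_le_smul hC⟩

lemma perAntennaGain_eq {M : ℕ} (H : Fin M → Fin K → ℂ) (k : Fin K) :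
    perAntennaGain H k = zfGain H k / M := by
  rw [perAntennaGain, zfGain, mul_inv, mul_comm, div_eq_mul_inv]

lemma effectiveGain_eq {M : ℕ} (H : Fin S.N → Fin M → Fin K → ℂ) (k : Fin K) :
    S.effectiveGain H k = (∏ n, zfGain (H n) k / M) ^ (1 / (S.N : ℝ)) := by
  simp only [effectiveGain, perAntennaGain_eq]

@[fun_prop]
lemma measurable_effectiveGain {M : ℕ} (k : Fin K) :
    Measurable fun H : Fin S.N → Fin M → Fin K → ℂ => S.effectiveGain H k := by
  simp only [effectiveGain_eq]
  fun_prop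

lemma N_cast_ne_zero : (S.N : ℝ) ≠ 0 := Nat.cast_ne_zero.2 S.N_pos.ne'

lemma effectiveGain_smul {M : ℕ} (H : Fin S.N → Fin M → Fin K → ℂ) (k : Fin K) {c : ℝ}
    (hc : c ≠ 0) : S.effectiveGain (c • H) k = c ^ 2 * S.effectiveGain H k := by
  rw [effectiveGain_eq, effectiveGain_eq]
  have h : ∏ n, zfGain ((c • H) n) k / M = (c ^ 2) ^ S.N * ∏ n, zfGain (H n) k / M := by
    simp only [Pi.smul_apply, zfGain_smul _ _ hc, mul_div_assoc, Finset.prod_mul_distrib]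
    simp
  rw [h, Real.mul_rpow (by positivity)
    (Finset.prod_nonneg fun n _ => div_nonneg (zfGain_nonneg _ _) M.cast_nonneg),
    one_div, Real.pow_rpow_inv_natCast (sq_nonneg c) S.N_pos.ne']

lemma ae_zfGain_pos {M : ℕ} (hM : K ≤ M) (k : Fin K) :
    ∀ᵐ H ∂(S.channelLaw M), ∀ n, 0 < zfGain (H n) k := by
  obtain ⟨C, hC⟩ := S.rowLaw_le_smul_volume
  refine ae_all_iff.2 fun n => ?_
  rw [channelLaw_eq]
  exact (measurePreserving_eval (fun _ : Fin S.N => Measure.pi fun _ : Fin M => S.rowLaw)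
    n).quasiMeasurePreserving.ae (_root_.ae_zfGain_pos S.rowLaw k hC hM)

lemma ae_effectiveGain_pos {M : ℕ} (hM : K ≤ M) (k : Fin K) :
    ∀ᵐ H ∂(S.channelLaw M), 0 < S.effectiveGain H k := by
  have hM0 : (0 : ℝ) < M := Nat.cast_pos.2 (k.pos.trans_le hM)
  filter_upwards [S.ae_zfGain_pos hM k] with H hH
  rw [effectiveGain_eq]
  exact Real.rpow_pos_of_pos (Finset.prod_pos fun n _ => div_pos (hH n) hM0) _

/-- Dividing the gain by `c ≥ 1` distorts its law at most by the power of `c` given by the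
number of complex channel coefficients. -/
lemma measure_effectiveGain_div_le (M : ℕ) (k : Fin K) {c : ℝ} (hc : 1 ≤ c) {T : Set ℝ}
    (hT : MeasurableSet T) :
    S.channelLaw M {H | S.effectiveGain H k / c ∈ T} ≤
      ENNReal.ofReal (c ^ (K * M * S.N)) * S.channelLaw M {H | S.effectiveGain H k ∈ T} := by
  have hc0 : 0 < c := one_pos.trans_le hc
  set s : ℝ≥0 := ⟨√c, Real.sqrt_nonneg c⟩ with hs
  have hs1 : 1 ≤ s := by
    rw [← NNReal.coe_le_coe]
    exact Real.one_le_sqrt.2 hc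
  have hs2 : (s : ℝ) ^ 2 = c := Real.sq_sqrt hc0.le
  have hs0 : (s : ℝ)⁻¹ ≠ 0 := by
    have : 0 < (s : ℝ) := lt_of_lt_of_le one_pos hs1
    positivity
  have h1 : ∀ k, (complexGaussian (S.estVar k)).map (fun z => ((s : ℝ)⁻¹ : ℝ) • z) ≤
      s ^ 2 • complexGaussian (S.estVar k) := fun k =>
    complexGaussian_map_inv_smul_le (S.estVar_pos k) hs1
  have h2 : S.rowLaw.map (fun h => (s : ℝ)⁻¹ • h) ≤ (∏ _k : Fin K, s ^ 2) • S.rowLaw :=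
    map_measure_pi_le_smul (fun k => by fun_prop) h1
  have h3 : (Measure.pi fun _ : Fin M => S.rowLaw).map (fun H => (s : ℝ)⁻¹ • H) ≤
      (∏ _i : Fin M, ∏ _k : Fin K, s ^ 2) • Measure.pi fun _ : Fin M => S.rowLaw :=
    map_measure_pi_le_smul (fun i => by fun_prop) fun _ => h2
  have h4 : (S.channelLaw M).map (fun H => (s : ℝ)⁻¹ • H) ≤
      (∏ _n : Fin S.N, ∏ _i : Fin M, ∏ _k : Fin K, s ^ 2) • S.channelLaw M :=
    map_measure_pi_le_smul (fun n => by fun_prop) fun _ => h3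
  have h5 := h4 {H | S.effectiveGain H k ∈ T}
  have hmT : MeasurableSet {H : Fin S.N → Fin M → Fin K → ℂ | S.effectiveGain H k ∈ T} :=
    S.measurable_effectiveGain k hT
  rw [Measure.map_apply (by fun_prop) hmT] at h5
  convert h5 using 1
  · congr 1
    ext H
    simp only [Set.mem_ofPred_eq, Set.mem_preimage, S.effectiveGain_smul H k hs0]
    rw [inv_pow, hs2, inv_mul_eq_div]
  · simp only [Finset.prod_const, Finset.card_univ, Fintype.card_fin, Measure.smul_apply,
      ENNReal.smul_def, smul_eq_mul, ← pow_mul]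
    congr 1
    rw [ENNReal.ofReal_pow hc0.le, ← hs2, ENNReal.ofReal_pow s.coe_nonneg, ENNReal.ofReal_coe_nnreal,
      ← pow_mul]
    push_cast
    ring

variable {M : ℕ} {k : Fin K}

lemma coe_gainCDF (x : ℝ) :
    (S.gainCDF M k x : ℝ) = (S.channelLaw M).real {H | S.effectiveGain H k ≤ x} := rfl

lemma gainCDF_mono : Monotone fun x => (S.gainCDF M k x : ℝ) := fun _ _ h =>
  measureReal_mono fun _ hH => le_trans hH h

lemma gainCDF_mul_le {c : ℝ} (hc : 1 ≤ c) (x : ℝ) :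
    (S.gainCDF M k (c * x) : ℝ) ≤ c ^ (K * M * S.N) * S.gainCDF M k x := by
  have hc0 : 0 < c := one_pos.trans_le hc
  have h := S.measure_effectiveGain_div_le M k hc (measurableSet_Iic (a := x))
  have h' := ENNReal.toReal_mono (by finiteness) h
  rw [ENNReal.toReal_mul, ENNReal.toReal_ofReal (by positivity)] at h'
  simp only [Set.mem_Iic, div_le_iff₀ hc0, mul_comm x] at h'
  exact h'

lemma tendsto_gainCDF_atTop :
    Tendsto (fun n : ℕ => (S.gainCDF M k n : ℝ)) atTop (𝓝 1) := by
  have hmono : Monotone fun n : ℕ =>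
      {H : Fin S.N → Fin M → Fin K → ℂ | S.effectiveGain H k ≤ n} := fun m n h H hH =>
    le_trans (show S.effectiveGain H k ≤ m from hH) (by exact_mod_cast h)
  have h := tendsto_measure_iUnion_atTop (μ := S.channelLaw M) hmono
  have hU : ⋃ n : ℕ, {H : Fin S.N → Fin M → Fin K → ℂ | S.effectiveGain H k ≤ n} = Set.univ :=
    Set.eq_univ_of_forall fun H => Set.mem_iUnion.2 (exists_nat_ge (S.effectiveGain H k))
  rw [hU, measure_univ] at h
  have h' := (ENNReal.tendsto_toReal ENNReal.one_ne_top).comp h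
  rwa [ENNReal.toReal_one] at h'

lemma gainCDF_pos {x : ℝ} (hx : 0 < x) : 0 < (S.gainCDF M k x : ℝ) := by
  obtain ⟨n, hn1, hn2⟩ := ((S.tendsto_gainCDF_atTop (M := M) (k := k)).eventually
    (lt_mem_nhds one_pos)).and (eventually_ge_atTop ⌈x⌉₊) |>.exists
  have hxn : x ≤ n := (Nat.le_ceil x).trans (by exact_mod_cast hn2)
  have h := S.gainCDF_mul_le (M := M) (k := k) ((one_le_div hx).2 hxn) x
  rw [div_mul_cancel₀ _ hx.ne'] at h
  have hpos : 0 < ((n : ℝ) / x) ^ (K * M * S.N) := pow_pos (div_pos (hx.trans_le hxn) hx) _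
  exact pos_of_mul_pos_right (hn1.trans_le h) hpos.le

lemma continuousAt_gainCDF {x : ℝ} (hx : 0 < x) :
    ContinuousAt (fun x => (S.gainCDF M k x : ℝ)) x := by
  set D := K * M * S.N
  have hlim : Tendsto (fun y : ℝ => (y / x) ^ D) (𝓝 x) (𝓝 1) := by
    have : Tendsto (fun y : ℝ => (y / x) ^ D) (𝓝 x) (𝓝 ((x / x) ^ D)) :=
      ((continuous_id.div_const x).pow D).tendsto x
    rwa [div_self hx.ne', one_pow] at this
  have h1 : Tendsto (fun y : ℝ => min 1 ((y / x) ^ D) * S.gainCDF M k x) (𝓝 x)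
      (𝓝 (S.gainCDF M k x)) := by
    simpa using ((tendsto_const_nhds (x := (1 : ℝ))).min hlim).mul_const (S.gainCDF M k x : ℝ)
  have h2 : Tendsto (fun y : ℝ => max 1 ((y / x) ^ D) * S.gainCDF M k x) (𝓝 x)
      (𝓝 (S.gainCDF M k x)) := by
    simpa using ((tendsto_const_nhds (x := (1 : ℝ))).max hlim).mul_const (S.gainCDF M k x : ℝ)
  have hF : 0 ≤ (S.gainCDF M k x : ℝ) := (S.gainCDF M k x).2.1
  refine tendsto_of_tendsto_of_tendsto_of_le_of_le' h1 h2 ?_ ?_ <;>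
    filter_upwards [lt_mem_nhds hx] with y hy
  · rcases le_total x y with hxy | hxy
    · exact (mul_le_of_le_one_left hF (min_le_left _ _)).trans (S.gainCDF_mono hxy)
    · have h := S.gainCDF_mul_le (M := M) (k := k) ((one_le_div hy).2 hxy) y
      rw [div_mul_cancel₀ _ hy.ne'] at h
      calc min 1 ((y / x) ^ D) * S.gainCDF M k x
          ≤ (y / x) ^ D * ((x / y) ^ D * S.gainCDF M k y) := by
            gcongr
            exact min_le_right _ _
        _ = S.gainCDF M k y := by
            rw [← mul_assoc, ← mul_pow, div_mul_div_cancel₀ hx.ne', div_self hy.ne', one_pow,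
              one_mul]
  · rcases le_total x y with hxy | hxy
    · have h := S.gainCDF_mul_le (M := M) (k := k) ((one_le_div hx).2 hxy) x
      rw [div_mul_cancel₀ _ hx.ne'] at h
      exact h.trans (by gcongr; exact le_max_right _ _)
    · exact (S.gainCDF_mono hxy).trans (le_mul_of_one_le_left hF (le_max_left _ _))

/-- Where it is below one, the distribution function increases strictly: if the gain avoided
`(x, y]`, it would by scaling avoid all intervals `(x (y/x)^j, x (y/x)^(j+1)]`, which
cover `(x, ∞)`. -/
lemma gainCDF_lt_gainCDF {x y : ℝ} (hx : 0 < x) (hxy : x < y)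
    (h1 : (S.gainCDF M k x : ℝ) < 1) : (S.gainCDF M k x : ℝ) < S.gainCDF M k y := by
  refine lt_of_le_of_ne (S.gainCDF_mono hxy.le) fun heq => h1.ne ?_
  set P := S.channelLaw M
  have hmx : ∀ z, MeasurableSet {H | S.effectiveGain (M := M) H k ≤ z} := fun z =>
    measurableSet_le (by fun_prop) measurable_const
  set c := y / x with hc
  have hc1 : 1 < c := (one_lt_div hx).2 hxy
  have hc0 : 0 < c := one_pos.trans hc1
  have hnull : P {H | S.effectiveGain H k ∈ Set.Ioc x y} = 0 := by
    have h2 : {H | S.effectiveGain (M := M) H k ∈ Set.Ioc x y} =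
        {H | S.effectiveGain H k ≤ y} \ {H | S.effectiveGain H k ≤ x} := by
      ext H
      simp [and_comm]
    have h3 := measureReal_sdiff (μ := P)
      (s₁ := {H | S.effectiveGain (M := M) H k ≤ y}) (s₂ := {H | S.effectiveGain H k ≤ x})
      (fun H hH => le_trans (show S.effectiveGain H k ≤ x from hH) hxy.le) (hmx x)
    rw [← h2, ← coe_gainCDF, ← coe_gainCDF, heq, sub_self] at h3
    exact (measureReal_eq_zero_iff).1 h3
  have hnull2 : P {H | x < S.effectiveGain H k} = 0 := by
    have hcov : {H | x < S.effectiveGain (M := M) H k} ⊆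
        ⋃ j : ℕ, {H | S.effectiveGain H k / c ^ j ∈ Set.Ioc x y} := by
      intro H hH
      have hH' : x < S.effectiveGain H k := hH
      obtain ⟨j, hj1, hj2⟩ := exists_nat_pow_near ((one_le_div hx).2 hH'.le) hc1
      refine Set.mem_iUnion.2 ?_
      rcases hj1.lt_or_eq with hj1 | hj1
      · refine ⟨j, ?_, ?_⟩
        · rw [lt_div_iff₀ (by positivity)]
          rwa [lt_div_iff₀ hx, mul_comm] at hj1
        · rw [div_le_iff₀ (by positivity)]
          rw [div_lt_iff₀ hx, pow_succ, hc, mul_assoc, div_mul_cancel₀ _ hx.ne', mul_comm] at hj2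
          exact hj2.le
      -- when the gain is the common endpoint `x c ^ j` of two intervals, `j ≠ 0` as it exceeds `x`
      · have hG : S.effectiveGain H k = c ^ j * x := by rw [hj1, div_mul_cancel₀ _ hx.ne']
        rcases j with _ | j
        · simp [hG] at hH'
        · refine ⟨j, ?_⟩
          have : S.effectiveGain H k / c ^ j = y := by
            rw [hG, pow_succ, mul_assoc, mul_div_cancel_left₀ _ (by positivity), hc,
              div_mul_cancel₀ _ hx.ne']
          rw [Set.mem_ofPred_eq, this]
          exact ⟨hxy, le_rfl⟩
    refine measure_mono_null hcov (measure_iUnion_null fun j => ?_)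
    have h4 := S.measure_effectiveGain_div_le M k (one_le_pow₀ hc1.le (n := j))
      (measurableSet_Ioc (a := x) (b := y))
    rw [hnull, mul_zero] at h4
    exact nonpos_iff_eq_zero.1 h4
  have h5 : {H | S.effectiveGain (M := M) H k ≤ x} = {H | x < S.effectiveGain H k}ᶜ := by
    ext H
    simp
  rw [coe_gainCDF, h5, measureReal_def, prob_compl_eq_one_sub
    (measurableSet_lt measurable_const (by fun_prop)), hnull2]
  simp

lemma exists_gainCDF_lt (hM : K ≤ M) {ε : ℝ} (hε : 0 < ε) :
    ∃ x : ℝ, 0 < x ∧ (S.gainCDF M k x : ℝ) < ε := by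
  have hanti : Antitone fun n : ℕ =>
      {H : Fin S.N → Fin M → Fin K → ℂ | S.effectiveGain H k ≤ 1 / ((n : ℝ) + 1)} :=
    fun m n h H hH => le_trans (show S.effectiveGain H k ≤ _ from hH)
      (one_div_le_one_div_of_le (by positivity) (by exact_mod_cast Nat.succ_le_succ h))
  have h := tendsto_measure_iInter_atTop (μ := S.channelLaw M)
    (fun n => (measurableSet_le (S.measurable_effectiveGain k)
      measurable_const).nullMeasurableSet) hanti ⟨0, by finiteness⟩
  have h0 : S.channelLaw M (⋂ n : ℕ,
      {H : Fin S.N → Fin M → Fin K → ℂ | S.effectiveGain H k ≤ 1 / ((n : ℝ) + 1)}) = 0 := by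
    refine measure_mono_null (fun H hH => ?_) (S.ae_effectiveGain_pos hM k)
    rw [Set.mem_iInter] at hH
    rw [Set.mem_compl_iff, Set.mem_ofPred_eq, not_lt]
    exact ge_of_tendsto' tendsto_one_div_add_atTop_nhds_zero_nat hH
  rw [h0] at h
  have h' := (ENNReal.tendsto_toReal ENNReal.zero_ne_top).comp h
  obtain ⟨n, hn⟩ := (h'.eventually (gt_mem_nhds hε)).exists
  exact ⟨1 / ((n : ℝ) + 1), by positivity, hn⟩

lemma gainInvCDF_eq_of_gainCDF_eq {ε : unitInterval} (h1 : (ε : ℝ) < 1) {z : ℝ} (hz : 0 < z)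
    (hF : (S.gainCDF M k z : ℝ) = ε) : S.gainInvCDF M k ε = z := by
  have hset : {x : ℝ | 0 < x ∧ ε ≤ S.gainCDF M k x} = Set.Ici z := by
    ext x
    simp only [Set.mem_ofPred_eq, Set.mem_Ici, ← Subtype.coe_le_coe]
    rw [← hF]
    refine ⟨fun h => ?_, fun h => ⟨hz.trans_le h, S.gainCDF_mono h⟩⟩
    by_contra hlt
    have hle : (S.gainCDF M k x : ℝ) ≤ S.gainCDF M k z := S.gainCDF_mono (not_le.1 hlt).le
    exact absurd h.2 (not_le.2 (S.gainCDF_lt_gainCDF h.1 (not_le.1 hlt)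
      (hle.trans_lt (hF ▸ h1))))
  rw [gainInvCDF, hset, csInf_Ici]

/-- With at least as many antennas as users, the inverse distribution function is a true
inverse. -/
lemma gainInvCDF_spec (hM : K ≤ M) {ε : unitInterval} (h0 : 0 < (ε : ℝ)) (h1 : (ε : ℝ) < 1) :
    0 < S.gainInvCDF M k ε ∧ (S.gainCDF M k (S.gainInvCDF M k ε) : ℝ) = ε := by
  obtain ⟨a, ha, haε⟩ := S.exists_gainCDF_lt (k := k) hM h0
  obtain ⟨b, hb⟩ := ((S.tendsto_gainCDF_atTop (M := M) (k := k)).eventually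
    (lt_mem_nhds h1)).exists
  have hab : a ≤ b := by
    by_contra hlt
    exact absurd (S.gainCDF_mono (M := M) (k := k) (not_le.1 hlt).le) (not_le.2 (haε.trans hb))
  have hcont : ContinuousOn (fun x => (S.gainCDF M k x : ℝ)) (Set.Icc a b) := fun x hx =>
    (S.continuousAt_gainCDF (ha.trans_le hx.1)).continuousWithinAt
  obtain ⟨z, hz, hzε⟩ := intermediate_value_Icc hab hcont ⟨haε.le, hb.le⟩
  have hz0 := ha.trans_le hz.1
  rw [S.gainInvCDF_eq_of_gainCDF_eq h1 hz0 hzε]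
  exact ⟨hz0, hzε⟩

/-- The probability of a small gain decays faster than every power of the number of antennas. -/
lemma tendsto_pow_mul_gainCDF (k : Fin K) {x : ℕ → ℝ} (hx : Tendsto x atTop (𝓝 0))
    (hx0 : ∀ᶠ M in atTop, 0 ≤ x M) (p : ℕ) :
    Tendsto (fun M : ℕ => (M : ℝ) ^ p * S.gainCDF M k (x M)) atTop (𝓝 0) := by
  obtain ⟨C, hC⟩ := S.rowLaw_le_smul_volume
  obtain ⟨x₀, hx₀, htail⟩ := exists_measure_zfGain_le S.rowLaw k hC
  have hbound : ∀ᶠ M : ℕ in atTop, (S.gainCDF M k (x M) : ℝ) ≤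
      S.N * (Real.exp (2 * K) * Real.exp (-M)) := by
    filter_upwards [hx0, hx.eventually (gt_mem_nhds hx₀), eventually_gt_atTop 0] with M h0 h1 h2
    have hM0 : (0 : ℝ) < M := Nat.cast_pos.2 h2
    have hsub : {H : Fin S.N → Fin M → Fin K → ℂ | S.effectiveGain H k ≤ x M} ⊆
        ⋃ n, {H | zfGain (H n) k ≤ x₀ * M} := by
      intro H hH
      by_contra hcon
      simp only [Set.mem_iUnion, Set.mem_ofPred_eq, not_exists, not_le] at hcon
      have h3 : x₀ ^ S.N ≤ ∏ n, zfGain (H n) k / M := by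
        calc x₀ ^ S.N = ∏ _n : Fin S.N, x₀ := by simp
          _ ≤ _ := Finset.prod_le_prod (fun _ _ => hx₀.le) fun n _ =>
            (le_div_iff₀ hM0).2 (hcon n).le
      have h4 : x₀ ≤ S.effectiveGain H k := by
        rw [effectiveGain_eq, one_div]
        calc x₀ = (x₀ ^ S.N) ^ ((S.N : ℝ)⁻¹) :=
              (Real.pow_rpow_inv_natCast hx₀.le S.N_pos.ne').symm
          _ ≤ _ := Real.rpow_le_rpow (by positivity) h3 (by positivity)
      exact absurd (h4.trans hH) (not_le.2 h1)
    have hn : ∀ n, S.channelLaw M {H | zfGain (H n) k ≤ x₀ * M} ≤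
        ENNReal.ofReal (Real.exp (2 * K) * Real.exp (-M)) := by
      intro n
      refine le_trans (le_of_eq ?_) (htail M)
      rw [channelLaw_eq]
      exact (measurePreserving_eval (fun _ : Fin S.N => Measure.pi fun _ : Fin M => S.rowLaw)
        n).measure_preimage (measurableSet_le (measurable_zfGain k)
          measurable_const).nullMeasurableSet
    have h5 : S.channelLaw M {H | S.effectiveGain H k ≤ x M} ≤
        ENNReal.ofReal (S.N * (Real.exp (2 * K) * Real.exp (-M))) := by
      calc _ ≤ ∑ n, S.channelLaw M {H | zfGain (H n) k ≤ x₀ * M} :=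
            (measure_mono hsub).trans (measure_iUnion_fintype_le _ _)
        _ ≤ ∑ _n : Fin S.N, ENNReal.ofReal (Real.exp (2 * K) * Real.exp (-M)) :=
            Finset.sum_le_sum fun n _ => hn n
        _ = _ := by
            rw [ENNReal.ofReal_mul (Nat.cast_nonneg _)]
            simp
    exact ENNReal.toReal_le_of_le_ofReal (by positivity) h5
  have hlim : Tendsto (fun M : ℕ => S.N * Real.exp (2 * K) * ((M : ℝ) ^ p * Real.exp (-M)))
      atTop (𝓝 0) := by
    simpa using ((Real.tendsto_pow_mul_exp_neg_atTop_nhds_zero p).comp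
      tendsto_natCast_atTop_atTop).const_mul (S.N * Real.exp (2 * K))
  refine tendsto_of_tendsto_of_tendsto_of_le_of_le' tendsto_const_nhds hlim ?_ ?_
  · exact Eventually.of_forall fun M =>
      mul_nonneg (pow_nonneg M.cast_nonneg _) (S.gainCDF M k (x M)).2.1
  · filter_upwards [hbound] with M hM
    calc _ ≤ (M : ℝ) ^ p * (S.N * (Real.exp (2 * K) * Real.exp (-M))) := by gcongr
      _ = _ := by ring

end Uplink

/-! ### Decoupling of the users -/

lemma longRunAverage_congr (ε : unitInterval) {lam : ℝ} (hlam : 0 ≤ lam) (μ : ℝ → ℝ)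
    {c c' : ℝ → ℝ} (h : ∀ q, 0 ≤ q → c q = c' q) :
    longRunAverage ε lam μ c = longRunAverage ε lam μ c' := by
  simp only [longRunAverage, h _ (queue_nonneg hlam _ _ _)]

namespace Uplink

variable {K : ℕ} (S : Uplink K)

lemma interference_pos (k : Fin K) : 0 < 1 + K / S.τ k + S.pI := by
  have h1 := S.pI_nonneg
  have h2 := S.τ_pos k
  positivity

lemma arrival_nonneg {M : ℕ} (k : Fin K) : 0 ≤ S.arrival M k :=
  div_nonneg (mul_nonneg (mul_nonneg (S.ρ_pos k).le S.N.cast_nonneg)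
    (Real.log_natCast_nonneg M)) S.L_pos.le

lemma arrival_pos {M : ℕ} (hM : 2 ≤ M) (k : Fin K) : 0 < S.arrival M k := by
  have h1 : 0 < Real.log M := Real.log_pos (by exact_mod_cast hM)
  have h2 : (0 : ℝ) < S.N := Nat.cast_pos.2 S.N_pos
  exact div_pos (mul_pos (mul_pos (S.ρ_pos k) h2) h1) S.L_pos

/-- The block error rate is the distribution function of the effective gain at the gain for which
power `p` just carries `r` packets. -/
lemma blockErrorRate_eq {M : ℕ} (hM : K ≤ M) (k : Fin K) {p : ℝ} (hp : 0 < p) (r : ℝ) :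
    S.blockErrorRate M k p r = S.gainCDF M k
      ((1 + K / S.τ k + S.pI) * (Real.exp (r * S.L / S.N) / (p * M * S.γ k))) := by
  have hM0 : (0 : ℝ) < M := Nat.cast_pos.2 (k.pos.trans_le hM)
  have hN : (0 : ℝ) < S.N := Nat.cast_pos.2 S.N_pos
  have hC := S.interference_pos k
  have hγ := S.γ_pos k
  rw [blockErrorRate, coe_gainCDF]
  refine measureReal_congr ?_
  filter_upwards [S.ae_zfGain_pos hM k] with H hH
  set A := p * S.γ k * M / (1 + K / S.τ k + S.pI) with hA
  have hA0 : 0 < A := by positivity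
  have hκ : ∀ n, 0 < zfGain (H n) k / M := fun n => div_pos (hH n) hM0
  have hprod : 0 < ∏ n, zfGain (H n) k / M := Finset.prod_pos fun n _ => hκ n
  have hgain : 0 < S.effectiveGain H k := by
    rw [effectiveGain_eq]; exact Real.rpow_pos_of_pos hprod _
  have h1 : ∀ n, S.sinr (H n) k p = A * (zfGain (H n) k / M) := by
    intro n
    rw [sinr, hA, zfGain, add_right_comm, ← div_div, div_eq_mul_inv (_ / _)]
    field_simp
  have h2 : ∑ n, Real.log (S.sinr (H n) k p) = S.N * Real.log (A * S.effectiveGain H k) := by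
    simp only [h1]
    rw [Real.log_mul hA0.ne' hgain.ne', effectiveGain_eq, Real.log_rpow hprod,
      Real.log_prod fun n _ => (hκ n).ne']
    simp only [Real.log_mul hA0.ne' (hκ _).ne', Finset.sum_add_distrib]
    simp
    field_simp
  refine propext ?_
  change ∑ n, Real.log (S.sinr (H n) k p) ≤ r * S.L ↔ S.effectiveGain H k ≤ _
  rw [h2, ← le_div_iff₀' hN, Real.log_le_iff_le_exp (mul_pos hA0 hgain), ← le_div_iff₀' hA0, hA]
  have : Real.exp (r * S.L / S.N) / (p * S.γ k * M / (1 + K / S.τ k + S.pI)) =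
      (1 + K / S.τ k + S.pI) * (Real.exp (r * S.L / S.N) / (p * M * S.γ k)) := by
    field_simp
  rw [this]

/-- Power inversion: the power mapping of the single-user problem is the only transmit power which
realizes the target error rate. -/
lemma eq_blockErrorRate_iff {M : ℕ} (hM : K ≤ M) (k : Fin K) {ε : unitInterval}
    (h0 : 0 < (ε : ℝ)) (h1 : (ε : ℝ) < 1) (p r : ℝ) :
    0 < p ∧ (ε : ℝ) = S.blockErrorRate M k p r ↔ p = S.powerMap M k r ε := by
  have hM0 : (0 : ℝ) < M := Nat.cast_pos.2 (k.pos.trans_le hM)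
  have hC := S.interference_pos k
  have hγ := S.γ_pos k
  obtain ⟨hz, hFz⟩ := S.gainInvCDF_spec (k := k) hM h0 h1
  constructor
  · rintro ⟨hp, hε⟩
    rw [S.blockErrorRate_eq hM k hp] at hε
    rw [powerMap, S.gainInvCDF_eq_of_gainCDF_eq h1 (by positivity) hε.symm]
    field_simp
  · rintro rfl
    have hp : 0 < S.powerMap M k r ε := by unfold powerMap; positivity
    refine ⟨hp, ?_⟩
    rw [S.blockErrorRate_eq hM k hp, ← hFz]
    congr 2
    rw [powerMap]
    field_simp

lemma multiuserLatency_eq (ω : Fin K → ℝ) (hω : ∀ k, 0 < ω k) {M : ℕ} (hM : K ≤ M) :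
    S.multiuserLatency ω M = ∑ k, ENNReal.ofReal (ω k) * S.minLatency M k := by
  refine le_antisymm ?_ ?_
  · by_cases htop : ∃ k, S.minLatency M k = ∞
    · obtain ⟨k, hk⟩ := htop
      have : ∑ k, ENNReal.ofReal (ω k) * S.minLatency M k = ∞ := by
        refine ENNReal.sum_eq_top.2 ⟨k, Finset.mem_univ k, ?_⟩
        rw [hk]
        exact ENNReal.mul_top (by simpa using hω k)
      rw [this]
      exact le_top
    push Not at htop
    refine ENNReal.le_of_forall_pos_le_add fun δ hδ _ => ?_
    set W := ∑ k, ENNReal.ofReal (ω k) with hW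
    have hWtop : W ≠ ∞ := ENNReal.sum_ne_top.2 fun k _ => ENNReal.ofReal_ne_top
    set δ' : ℝ≥0∞ := δ / (W + 1) with hδ'
    have hδ'0 : δ' ≠ 0 := ENNReal.div_ne_zero.2 ⟨by simpa using hδ.ne', by finiteness⟩
    have hnear : ∀ k, ∃ (ε : unitInterval) (μ : ℝ → ℝ), (S.IsControl k ε μ ∧
        S.averagePower M k ε μ ≤ ENNReal.ofReal (S.P k)) ∧
        latency ε (S.arrival M k) μ < S.minLatency M k + δ' := by
      intro k
      have h := ENNReal.lt_add_right (htop k) hδ'0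
      conv_lhs at h => rw [minLatency]
      simpa only [iInf_lt_iff, exists_prop] using h
    choose ε μ hfeas hlat using hnear
    calc S.multiuserLatency ω M
        ≤ ∑ k, ENNReal.ofReal (ω k) * latency (ε k) (S.arrival M k) (μ k) := by
          refine (iInf_le _ ε).trans ((iInf_le _ μ).trans ((iInf_le _
            fun k q => S.powerMap M k (μ k q) (ε k)).trans (iInf_le _ fun k => ?_)))
          have hc := (hfeas k).1
          exact ⟨hc, fun q _ => (S.eq_blockErrorRate_iff hM k hc.1 hc.2.1 _ _).2 rfl,
            (hfeas k).2⟩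
      _ ≤ ∑ k, ENNReal.ofReal (ω k) * (S.minLatency M k + δ') := by
          gcongr with k
          exact (hlat k).le
      _ = ∑ k, ENNReal.ofReal (ω k) * S.minLatency M k + W * δ' := by
          simp only [mul_add, Finset.sum_add_distrib, hW, Finset.sum_mul]
      _ ≤ _ := by
          gcongr
          calc W * δ' ≤ (W + 1) * δ' := by gcongr; exact le_self_add
            _ = δ := ENNReal.mul_div_cancel (by simp) (by finiteness)
  · refine le_iInf fun ε => le_iInf fun μ => le_iInf fun p => le_iInf fun h => ?_
    gcongr with k
    obtain ⟨hc, hp, hP⟩ := h k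
    refine (iInf_le _ (ε k)).trans ((iInf_le _ (μ k)).trans (iInf_le _ ⟨hc, ?_⟩))
    rw [averagePower, ← longRunAverage_congr (ε k) (S.arrival_nonneg k) (μ k) fun q hq =>
      (S.eq_blockErrorRate_iff hM k hc.1 hc.2.1 _ _).1 (hp q hq)]
    exact hP

end Uplink

/-! ### The queue when all packets up to twice the arrival rate are sent -/

section LyrrcQueue

variable {ε : unitInterval} {lam : ℝ}

/-- The queue in units of `lam` is a birth-death chain which moves up with probability `ε`. Started
at its minimum, it stays below its geometric stationary law, of ratio `ε / (1 - ε)`. -/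
lemma lintegral_queue_gt_le (h1 : (ε : ℝ) < 1) (hlam : 0 < lam) (t i : ℕ) :
    ∫⁻ s, (Set.Ioi (i * lam)).indicator 1 (queue lam (fun q => min q (2 * lam)) s t)
      ∂(successLaw ε) ≤ ENNReal.ofReal (ε / (1 - ε)) ^ i := by
  set μ : ℝ → ℝ := fun q => min q (2 * lam) with hμ
  have h0 : 0 ≤ (ε : ℝ) := ε.2.1
  have hε' : 0 < 1 - (ε : ℝ) := sub_pos.2 h1
  have hr : 0 ≤ (ε : ℝ) / (1 - ε) := div_nonneg h0 hε'.le
  induction t generalizing i with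
  | zero =>
    have : ∀ s, (Set.Ioi (i * lam)).indicator (1 : ℝ → ℝ≥0∞) (queue lam μ s 0) = 0 := fun s =>
      Set.indicator_of_notMem (by simpa [queue] using by positivity) _
    simp [this]
  | succ t ih =>
    rcases i with _ | i
    · rw [pow_zero]
      refine (lintegral_mono (g := fun _ => 1) fun s => ?_).trans (by simp)
      exact Set.indicator_apply_le' (fun _ => le_rfl) fun _ => zero_le
    rw [lintegral_queue_succ]
    have hup : ∀ s, (Set.Ioi (((i + 1 : ℕ) : ℝ) * lam)).indicator (1 : ℝ → ℝ≥0∞)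
        (max (queue lam μ s t + lam) lam) ≤
        (Set.Ioi ((i : ℝ) * lam)).indicator 1 (queue lam μ s t) := by
      intro s
      refine Set.indicator_apply_le' (fun h => ?_) fun _ => zero_le
      rw [Set.indicator_of_mem]
      · exact le_rfl
      · have hi : 0 ≤ (i : ℝ) * lam := by positivity
        rw [Set.mem_Ioi] at h ⊢
        push_cast at h
        rcases lt_max_iff.1 h with h | h <;> linarith
    have hdown : ∀ s, (Set.Ioi (((i + 1 : ℕ) : ℝ) * lam)).indicator (1 : ℝ → ℝ≥0∞)
        (max (queue lam μ s t + lam - μ (queue lam μ s t)) lam) ≤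
        (Set.Ioi (((i + 2 : ℕ) : ℝ) * lam)).indicator 1 (queue lam μ s t) := by
      intro s
      refine Set.indicator_apply_le' (fun h => ?_) fun _ => zero_le
      rw [Set.indicator_of_mem]
      · exact le_rfl
      · have hi : 0 ≤ (i : ℝ) * lam := by positivity
        rw [Set.mem_Ioi] at h ⊢
        push_cast at h ⊢
        rcases lt_max_iff.1 h with h | h
        · rcases min_cases (queue lam μ s t) (2 * lam) with hm | hm
          · simp only [hμ] at h
            linarith
          · simp only [hμ] at h
            linarith
        · linarith
    have hid : (ε : ℝ) * (ε / (1 - ε)) ^ i + (1 - ε) * (ε / (1 - ε)) ^ (i + 2) =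
        (ε / (1 - ε)) ^ (i + 1) := by
      have : (ε : ℝ) = (ε / (1 - ε)) * (1 - ε) := (div_mul_cancel₀ _ hε'.ne').symm
      set r : ℝ := ε / (1 - ε) with hrdef
      calc (ε : ℝ) * r ^ i + (1 - ε) * r ^ (i + 2)
          = (r * (1 - ε)) * r ^ i + (1 - ε) * r * r ^ (i + 1) := by rw [← this]; ring
        _ = r ^ (i + 1) * ((1 - ε) + r * (1 - ε)) := by ring
        _ = _ := by rw [← this]; ring
    calc _ ≤ ENNReal.ofReal ε * ENNReal.ofReal (ε / (1 - ε)) ^ i +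
          ENNReal.ofReal (1 - ε) * ENNReal.ofReal (ε / (1 - ε)) ^ (i + 2) := by
          gcongr
          · exact (lintegral_mono hup).trans (ih i)
          · exact (lintegral_mono hdown).trans (ih (i + 2))
      _ = _ := by
          rw [← ENNReal.ofReal_pow hr, ← ENNReal.ofReal_pow hr, ← ENNReal.ofReal_pow hr,
            ← ENNReal.ofReal_mul h0, ← ENNReal.ofReal_mul hε'.le, ← ENNReal.ofReal_add
            (by positivity) (by positivity), hid]

lemma ofReal_le_tsum_indicator (x : ℝ) :
    ENNReal.ofReal x ≤ ∑' i : ℕ, (Set.Ioi (i : ℝ)).indicator 1 x := by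
  calc ENNReal.ofReal x ≤ (⌈x⌉₊ : ℝ≥0∞) := by
        rw [← ENNReal.ofReal_natCast]
        exact ENNReal.ofReal_le_ofReal (Nat.le_ceil x)
    _ = ∑ i ∈ Finset.range ⌈x⌉₊, (Set.Ioi (i : ℝ)).indicator (1 : ℝ → ℝ≥0∞) x := by
        rw [Finset.sum_congr rfl fun i hi => Set.indicator_of_mem
          (Set.mem_Ioi.2 (Nat.lt_ceil.1 (Finset.mem_range.1 hi))) _]
        simp
    _ ≤ _ := ENNReal.sum_le_tsum _

lemma latency_min_le (h1 : (ε : ℝ) < 1 / 2) (hlam : 0 < lam) :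
    latency ε lam (fun q => min q (2 * lam)) ≤ ENNReal.ofReal (1 + ε / (1 - 2 * ε)) := by
  set μ : ℝ → ℝ := fun q => min q (2 * lam) with hμ
  have h0 : 0 ≤ (ε : ℝ) := ε.2.1
  have hr0 : 0 ≤ (ε : ℝ) / (1 - ε) := div_nonneg h0 (by linarith)
  have hr1 : (ε : ℝ) / (1 - ε) < 1 := (div_lt_one (by linarith)).2 (by linarith)
  refine longRunAverage_le ε lam μ _ _ fun t => ?_
  calc ∫⁻ s, ENNReal.ofReal (queue lam μ s t / lam) ∂(successLaw ε)
      ≤ ∫⁻ s, ∑' i : ℕ, (Set.Ioi (i * lam)).indicator 1 (queue lam μ s t) ∂(successLaw ε) := by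
        refine lintegral_mono fun s => (ofReal_le_tsum_indicator _).trans (le_of_eq ?_)
        refine tsum_congr fun i => ?_
        simp only [Set.indicator_apply, Set.mem_Ioi, lt_div_iff₀ hlam]
        rfl
    _ = ∑' i : ℕ, ∫⁻ s, (Set.Ioi (i * lam)).indicator 1 (queue lam μ s t) ∂(successLaw ε) :=
        lintegral_tsum fun i => (measurable_comp_queue _ lam μ t).aemeasurable
    _ ≤ ∑' i : ℕ, ENNReal.ofReal (ε / (1 - ε)) ^ i :=
        ENNReal.tsum_le_tsum fun i => lintegral_queue_gt_le (by linarith) hlam t i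
    _ = ENNReal.ofReal (1 + ε / (1 - 2 * ε)) := by
        rw [ENNReal.tsum_geometric, ← ENNReal.ofReal_one, ← ENNReal.ofReal_sub _ hr0,
          ← ENNReal.ofReal_inv_of_pos (by linarith)]
        congr 1
        have h2 : (1 : ℝ) - ε ≠ 0 := by linarith
        have h3 : (1 : ℝ) - 2 * ε ≠ 0 := by linarith
        have h4 : (1 : ℝ) - ε / (1 - ε) = (1 - 2 * ε) / (1 - ε) := by field_simp; ring
        rw [h4, inv_div, one_add_div h3]
        congr 1
        ring

lemma longRunAverage_exp_min_le (h1 : (ε : ℝ) < 1) (hlam : 0 < lam) {A b : ℝ} (hA : 0 < A)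
    (hb : 0 < b) :
    longRunAverage ε lam (fun q => min q (2 * lam))
      (fun q => A * Real.exp (min q (2 * lam) * b)) ≤
      ENNReal.ofReal (A * Real.exp (lam * b) * (1 + Real.exp (lam * b) * (ε / (1 - ε)))) := by
  set μ : ℝ → ℝ := fun q => min q (2 * lam) with hμ
  have h0 : 0 ≤ (ε : ℝ) := ε.2.1
  have hr0 : 0 ≤ (ε : ℝ) / (1 - ε) := div_nonneg h0 (by linarith)
  refine longRunAverage_le ε lam μ _ _ fun t => ?_
  set B := A * Real.exp (lam * b) with hB
  have hB0 : 0 < B := by positivity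
  have hpt : ∀ q : ℝ, ENNReal.ofReal (A * Real.exp (min q (2 * lam) * b)) ≤
      ENNReal.ofReal B + ENNReal.ofReal (B * Real.exp (lam * b)) *
        (Set.Ioi (((1 : ℕ) : ℝ) * lam)).indicator 1 q := by
    intro q
    rcases le_or_gt q lam with hq | hq
    · refine le_add_right (ENNReal.ofReal_le_ofReal ?_)
      rw [hB]
      gcongr
      exact (min_le_left _ _).trans hq
    · rw [Set.indicator_of_mem (by simpa using hq), Pi.one_apply, mul_one]
      refine le_add_left (ENNReal.ofReal_le_ofReal ?_)
      rw [hB, mul_assoc, ← Real.exp_add]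
      gcongr
      calc min q (2 * lam) * b ≤ 2 * lam * b := by gcongr; exact min_le_right _ _
        _ = _ := by ring
  calc ∫⁻ s, ENNReal.ofReal (A * Real.exp (min (queue lam μ s t) (2 * lam) * b)) ∂(successLaw ε)
      ≤ ∫⁻ s, (ENNReal.ofReal B + ENNReal.ofReal (B * Real.exp (lam * b)) *
          (Set.Ioi (((1 : ℕ) : ℝ) * lam)).indicator 1 (queue lam μ s t)) ∂(successLaw ε) :=
        lintegral_mono fun s => hpt _
    _ = ENNReal.ofReal B + ENNReal.ofReal (B * Real.exp (lam * b)) *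
          ∫⁻ s, (Set.Ioi (((1 : ℕ) : ℝ) * lam)).indicator 1 (queue lam μ s t)
            ∂(successLaw ε) := by
        rw [lintegral_add_left measurable_const,
          lintegral_const_mul _ (measurable_comp_queue _ lam μ t)]
        simp
    _ ≤ ENNReal.ofReal B + ENNReal.ofReal (B * Real.exp (lam * b)) *
          ENNReal.ofReal (ε / (1 - ε)) ^ 1 := by
        gcongr
        exact lintegral_queue_gt_le h1 hlam t 1
    _ = _ := by
        rw [pow_one, ← ENNReal.ofReal_mul (by positivity),
          ← ENNReal.ofReal_add (by positivity) (by positivity)]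
        congr 1
        ring

lemma le_longRunAverage_exp_min (hlam : 0 < lam) {A b : ℝ} (hA : 0 < A) (hb : 0 < b) :
    ENNReal.ofReal (A * Real.exp (lam * b)) ≤
      longRunAverage ε lam (fun q => min q (2 * lam))
        (fun q => A * Real.exp (min q (2 * lam) * b)) := by
  refine le_longRunAverage ε lam _ _ _ ENNReal.ofReal_ne_top fun t ht => ?_
  calc ENNReal.ofReal (A * Real.exp (lam * b))
      = ∫⁻ _, ENNReal.ofReal (A * Real.exp (lam * b)) ∂(successLaw ε) := by simp
    _ ≤ _ := by
        refine lintegral_mono fun s => ENNReal.ofReal_le_ofReal ?_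
        gcongr
        exact le_min (arrival_le_queue lam _ s (by omega)) (by linarith)

end LyrrcQueue

/-! ### Asymptotics for a large number of antennas -/

namespace Uplink

variable {K : ℕ} (S : Uplink K)

/-- The effective gain at which transmitting one frame's arrivals takes exactly the power budget;
the target error rate of LYRRC is the probability of a smaller gain. -/
def lyrrcGain (M : ℕ) (k : Fin K) : ℝ :=
  1 / (M : ℝ) ^ (1 - S.ρ k) * (1 + K / S.τ k + S.pI) * (1 / (S.γ k * S.P k))

lemma lyrrcError_eq (M : ℕ) (k : Fin K) : S.lyrrcError M k = S.gainCDF M k (S.lyrrcGain M k) :=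
  rfl

lemma lyrrcGain_pos {M : ℕ} (hM : 0 < M) (k : Fin K) : 0 < S.lyrrcGain M k := by
  have h1 : (0 : ℝ) < M := Nat.cast_pos.2 hM
  have h2 := S.interference_pos k
  have h3 := S.γ_pos k
  have h4 := S.P_pos k
  unfold lyrrcGain
  positivity

lemma tendsto_lyrrcGain (k : Fin K) : Tendsto (fun M => S.lyrrcGain M k) atTop (𝓝 0) := by
  have h1 : Tendsto (fun M : ℕ => 1 / (M : ℝ) ^ (1 - S.ρ k)) atTop (𝓝 0) := by
    simp only [one_div]
    exact ((tendsto_rpow_atTop (sub_pos.2 (S.ρ_lt_one k))).comp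
      tendsto_natCast_atTop_atTop).inv_tendsto_atTop
  simpa [lyrrcGain] using (h1.mul_const (1 + K / S.τ k + S.pI)).mul_const (1 / (S.γ k * S.P k))

lemma exp_arrival {M : ℕ} (hM : 0 < M) (k : Fin K) :
    Real.exp (S.arrival M k * (S.L / S.N)) = (M : ℝ) ^ S.ρ k := by
  rw [Real.rpow_def_of_pos (Nat.cast_pos.2 hM), arrival]
  congr 1
  have h1 := S.N_cast_ne_zero
  have h2 := S.L_pos.ne'
  field_simp

/-- The power for the transmission of an empty frame. -/
def basePower (M : ℕ) (k : Fin K) (ε : unitInterval) : ℝ :=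
  (1 + K / S.τ k + S.pI) / (S.gainInvCDF M k ε * M * S.γ k)

lemma powerMap_eq (M : ℕ) (k : Fin K) (r : ℝ) (ε : unitInterval) :
    S.powerMap M k r ε = S.basePower M k ε * Real.exp (r * (S.L / S.N)) := by
  rw [powerMap, basePower, mul_div_assoc]
  ring

lemma basePower_pos {M : ℕ} (hM : 0 < M) (k : Fin K) {ε : unitInterval}
    (h : 0 < S.gainInvCDF M k ε) : 0 < S.basePower M k ε := by
  have h1 : (0 : ℝ) < M := Nat.cast_pos.2 hM
  have h2 := S.interference_pos k
  have h3 := S.γ_pos k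
  unfold basePower
  positivity

lemma basePower_mul_exp_arrival {M : ℕ} (hM : 0 < M) (k : Fin K) (ε : unitInterval) :
    S.basePower M k ε * Real.exp (S.arrival M k * (S.L / S.N)) =
      S.P k * (S.lyrrcGain M k / S.gainInvCDF M k ε) := by
  have h1 : (0 : ℝ) < M := Nat.cast_pos.2 hM
  have h3 := (S.γ_pos k).ne'
  have h4 := (S.P_pos k).ne'
  have h5 : (M : ℝ) ^ S.ρ k ≠ 0 := (Real.rpow_pos_of_pos h1 _).ne'
  rw [S.exp_arrival hM, basePower, lyrrcGain, Real.rpow_sub h1, Real.rpow_one]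
  field_simp

/-- Every control within the power budget has error rate at least that of LYRRC, or infinite
latency. -/
lemma one_add_lyrrcError_le_minLatency {M : ℕ} (hM : 2 ≤ M) (hK : K ≤ M) (k : Fin K) :
    1 + ENNReal.ofReal (S.lyrrcError M k) ≤ S.minLatency M k := by
  refine le_iInf fun ε => le_iInf fun μ => le_iInf fun ⟨hc, hP⟩ => ?_
  have hM0 : 0 < M := by omega
  have hlam := S.arrival_pos hM k
  by_cases hfin : latency ε (S.arrival M k) μ = ∞
  · rw [hfin]; exact le_top
  refine le_trans ?_ (one_add_le_latency ε hlam μ)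
  gcongr
  obtain ⟨hz, hFz⟩ := S.gainInvCDF_spec (k := k) hK hc.1 hc.2.1
  have hb : 0 < S.L / S.N := div_pos S.L_pos (Nat.cast_pos.2 S.N_pos)
  have h1 := le_longRunAverage_exp ε hlam hc.2.2.2 hfin (S.basePower_pos hM0 k hz) hb
  simp only [averagePower, powerMap_eq] at hP
  have h2 := (ENNReal.ofReal_le_ofReal_iff (S.P_pos k).le).1 (h1.trans hP)
  rw [S.basePower_mul_exp_arrival hM0] at h2
  have h3 : S.lyrrcGain M k / S.gainInvCDF M k ε ≤ 1 := by
    by_contra hlt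
    exact absurd h2 (not_le.2 (lt_mul_of_one_lt_right (S.P_pos k) (not_le.1 hlt)))
  rw [div_le_one hz] at h3
  have h4 : (S.lyrrcError M k : ℝ) ≤ S.gainCDF M k (S.gainInvCDF M k ε) := S.gainCDF_mono h3
  rwa [hFz] at h4

lemma averagePower_lyrrcRate_le {M : ℕ} (hM : 2 ≤ M) (k : Fin K) {ε : unitInterval}
    (h1 : (ε : ℝ) < 1 / 2) (hz : 0 < S.gainInvCDF M k ε) :
    S.averagePower M k ε (S.lyrrcRate M k) ≤ ENNReal.ofReal
      (S.P k * (S.lyrrcGain M k / S.gainInvCDF M k ε) * (1 + 2 * (M * ε))) := by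
  have hM0 : 0 < M := by omega
  have h0 : 0 ≤ (ε : ℝ) := ε.2.1
  have hb : 0 < S.L / S.N := div_pos S.L_pos (Nat.cast_pos.2 S.N_pos)
  simp only [averagePower, powerMap_eq]
  refine (longRunAverage_exp_min_le (by linarith) (S.arrival_pos hM k)
    (S.basePower_pos hM0 k hz) hb).trans (ENNReal.ofReal_le_ofReal ?_)
  rw [S.basePower_mul_exp_arrival hM0, S.exp_arrival hM0]
  have hP := S.P_pos k
  have hx := S.lyrrcGain_pos hM0 k
  have hMρ : (M : ℝ) ^ S.ρ k ≤ M := by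
    calc (M : ℝ) ^ S.ρ k ≤ (M : ℝ) ^ (1 : ℝ) :=
          Real.rpow_le_rpow_of_exponent_le (by exact_mod_cast hM0) (S.ρ_lt_one k).le
      _ = M := Real.rpow_one _
  have hr : (ε : ℝ) / (1 - ε) ≤ 2 * ε := by
    rw [div_le_iff₀ (by linarith)]
    nlinarith
  have hr0 : 0 ≤ (ε : ℝ) / (1 - ε) := div_nonneg h0 (by linarith)
  have : (M : ℝ) ^ S.ρ k * (ε / (1 - ε)) ≤ 2 * (M * ε) := by
    calc _ ≤ (M : ℝ) * (2 * ε) := by gcongr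
      _ = _ := by ring
  gcongr

lemma le_averagePower_lyrrcRate {M : ℕ} (hM : 2 ≤ M) (k : Fin K) {ε : unitInterval}
    (hz : 0 < S.gainInvCDF M k ε) :
    ENNReal.ofReal (S.P k * (S.lyrrcGain M k / S.gainInvCDF M k ε)) ≤
      S.averagePower M k ε (S.lyrrcRate M k) := by
  have hM0 : 0 < M := by omega
  have hb : 0 < S.L / S.N := div_pos S.L_pos (Nat.cast_pos.2 S.N_pos)
  simp only [averagePower, powerMap_eq]
  rw [← S.basePower_mul_exp_arrival hM0]
  exact le_longRunAverage_exp_min (S.arrival_pos hM k) (S.basePower_pos hM0 k hz) hb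

lemma isControl_lyrrcRate (M : ℕ) (k : Fin K) {ε : unitInterval} (h0 : 0 < (ε : ℝ))
    (h1 : (ε : ℝ) < 1) (h2 : (ε : ℝ) ≤ S.εmax k) : S.IsControl k ε (S.lyrrcRate M k) :=
  ⟨h0, h1, h2, fun _ hq => le_min hq (mul_nonneg zero_le_two (S.arrival_nonneg k))⟩

/-- A power of the number of antennas times the error rate of LYRRC, or of its modification with
slightly larger effective gain, vanishes asymptotically. -/
lemma tendsto_pow_mul_gainCDF_lyrrcGain (k : Fin K) {c : ℕ → ℝ} (hc : Tendsto c atTop (𝓝 1))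
    (p : ℕ) :
    Tendsto (fun M : ℕ => (M : ℝ) ^ p * S.gainCDF M k (c M * S.lyrrcGain M k)) atTop (𝓝 0) := by
  refine S.tendsto_pow_mul_gainCDF k (by simpa using hc.mul (S.tendsto_lyrrcGain k)) ?_ p
  filter_upwards [hc.eventually (lt_mem_nhds one_pos), eventually_gt_atTop 0] with M h1 h2
  exact (mul_pos h1 (S.lyrrcGain_pos h2 k)).le

lemma tendsto_pow_mul_lyrrcError (k : Fin K) (p : ℕ) :
    Tendsto (fun M : ℕ => (M : ℝ) ^ p * S.lyrrcError M k) atTop (𝓝 0) := by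
  simpa [lyrrcError_eq] using
    S.tendsto_pow_mul_gainCDF_lyrrcGain k (tendsto_const_nhds (x := (1 : ℝ))) p

lemma tendsto_lyrrcError (k : Fin K) :
    Tendsto (fun M : ℕ => (S.lyrrcError M k : ℝ)) atTop (𝓝 0) := by
  simpa using S.tendsto_pow_mul_lyrrcError k 0

lemma eventually_lyrrcError_mem (k : Fin K) : ∀ᶠ M in atTop,
    2 ≤ M ∧ K ≤ M ∧ 0 < (S.lyrrcError M k : ℝ) ∧ (S.lyrrcError M k : ℝ) < 1 / 2 := by
  filter_upwards [eventually_ge_atTop 2, eventually_ge_atTop K,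
    (S.tendsto_lyrrcError k).eventually (gt_mem_nhds one_half_pos)] with M h1 h2 h3
  exact ⟨h1, h2, S.gainCDF_pos (S.lyrrcGain_pos (by omega) k), h3⟩

lemma tendsto_averagePower_lyrrc (k : Fin K) :
    Tendsto (fun M => S.averagePower M k (S.lyrrcError M k) (S.lyrrcRate M k)) atTop
      (𝓝 (ENNReal.ofReal (S.P k))) := by
  have hlim : Tendsto (fun M : ℕ => ENNReal.ofReal (S.P k * (1 + 2 * (M * S.lyrrcError M k))))
      atTop (𝓝 (ENNReal.ofReal (S.P k))) := by
    refine ENNReal.tendsto_ofReal ?_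
    have := ((S.tendsto_pow_mul_lyrrcError k 1).const_mul 2).const_add 1 |>.const_mul (S.P k)
    simpa using this
  refine tendsto_of_tendsto_of_tendsto_of_le_of_le' tendsto_const_nhds hlim ?_ ?_ <;>
    filter_upwards [S.eventually_lyrrcError_mem k] with M ⟨h1, h2, h3, h4⟩
  all_goals
    have hx := S.lyrrcGain_pos (by omega : 0 < M) k
    have hz : S.gainInvCDF M k (S.lyrrcError M k) = S.lyrrcGain M k :=
      S.gainInvCDF_eq_of_gainCDF_eq (by linarith) hx rfl
    have hz0 : 0 < S.gainInvCDF M k (S.lyrrcError M k) := hz.symm ▸ hx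
    have hdiv : S.lyrrcGain M k / S.gainInvCDF M k (S.lyrrcError M k) = 1 := by
      rw [hz, div_self hx.ne']
  · have h := S.le_averagePower_lyrrcRate h1 k hz0
    rwa [hdiv, mul_one] at h
  · have h := S.averagePower_lyrrcRate_le h1 k h4 hz0
    rwa [hdiv, mul_one] at h

lemma eventually_lyrrcLatency_ne_top (k : Fin K) : ∀ᶠ M in atTop, S.lyrrcLatency M k ≠ ∞ := by
  filter_upwards [S.eventually_lyrrcError_mem k] with M ⟨h1, _, _, h4⟩
  exact ne_top_of_le_ne_top ENNReal.ofReal_ne_top (latency_min_le h4 (S.arrival_pos h1 k))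

/-- A sandwich on the latency in real numbers. -/
lemma div_mem_Icc_of_latency_mem {D : ℝ≥0∞} {e u : ℝ} (he : 0 < e) (hu : 0 ≤ u)
    (h1 : 1 + ENNReal.ofReal e ≤ D) (h2 : D ≤ ENNReal.ofReal (1 + u)) :
    1 ≤ (D.toReal - 1) / e ∧ (D.toReal - 1) / e ≤ u / e := by
  have hD : D ≠ ∞ := ne_top_of_le_ne_top ENNReal.ofReal_ne_top h2
  rw [← ENNReal.ofReal_one, ← ENNReal.ofReal_add zero_le_one he.le,
    ENNReal.ofReal_le_iff_le_toReal hD] at h1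
  have h2' := ENNReal.toReal_le_of_le_ofReal (by positivity) h2
  exact ⟨(one_le_div he).2 (by linarith), by gcongr; linarith⟩

lemma tendsto_lyrrcLatency (k : Fin K) :
    Tendsto (fun M => ((S.lyrrcLatency M k).toReal - 1) / (S.lyrrcError M k : ℝ)) atTop
      (𝓝 1) := by
  have hlim : Tendsto (fun M => 1 / (1 - 2 * (S.lyrrcError M k : ℝ))) atTop (𝓝 1) := by
    have h := ((S.tendsto_lyrrcError k).const_mul 2).const_sub 1
    simpa using h.inv₀ (by norm_num)
  have hmain : ∀ᶠ M in atTop,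
      1 ≤ ((S.lyrrcLatency M k).toReal - 1) / (S.lyrrcError M k : ℝ) ∧
      ((S.lyrrcLatency M k).toReal - 1) / (S.lyrrcError M k : ℝ) ≤
        1 / (1 - 2 * (S.lyrrcError M k : ℝ)) := by
    filter_upwards [S.eventually_lyrrcError_mem k] with M ⟨h1, _, h3, h4⟩
    have hu : 0 ≤ (S.lyrrcError M k : ℝ) / (1 - 2 * S.lyrrcError M k) :=
      div_nonneg h3.le (by linarith)
    have h := div_mem_Icc_of_latency_mem h3 hu (one_add_le_latency _ (S.arrival_pos h1 k) _)
      (latency_min_le h4 (S.arrival_pos h1 k))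
    rw [div_div_cancel_left' h3.ne', ← one_div] at h
    exact h
  exact tendsto_of_tendsto_of_tendsto_of_le_of_le' tendsto_const_nhds hlim
    (hmain.mono fun _ h => h.1) (hmain.mono fun _ h => h.2)

/-- LYRRC slightly exceeds the power budget. Enlarging the effective gain by the factor `1 + M⁻²`
makes it feasible, because its excess power is superpolynomially small, while the error rate grows
at most by the factor `(1 + M⁻²) ^ (K M N)`, which tends to one. -/
lemma eventually_minLatency_le (k : Fin K) : ∀ᶠ M : ℕ in atTop,
    S.minLatency M k ≤ ENNReal.ofReal
      (1 + S.gainCDF M k ((1 + ((M : ℝ) ^ 2)⁻¹) * S.lyrrcGain M k) /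
        (1 - 2 * S.gainCDF M k ((1 + ((M : ℝ) ^ 2)⁻¹) * S.lyrrcGain M k))) := by
  have hc : Tendsto (fun M : ℕ => 1 + ((M : ℝ) ^ 2)⁻¹) atTop (𝓝 1) := by
    have : Tendsto (fun M : ℕ => ((M : ℝ) ^ 2)⁻¹) atTop (𝓝 0) :=
      ((tendsto_pow_atTop two_ne_zero).comp tendsto_natCast_atTop_atTop).inv_tendsto_atTop
    simpa using this.const_add 1
  have h0 := S.tendsto_pow_mul_gainCDF_lyrrcGain k hc 0
  have h3 := S.tendsto_pow_mul_gainCDF_lyrrcGain k hc 3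
  simp only [pow_zero, one_mul] at h0
  filter_upwards [eventually_ge_atTop 2, h0.eventually (gt_mem_nhds one_half_pos),
    h0.eventually (gt_mem_nhds (S.εmax_pos k)), h3.eventually (gt_mem_nhds one_half_pos)]
    with M hM hε1 hε2 hε3
  set c : ℝ := 1 + ((M : ℝ) ^ 2)⁻¹ with hcdef
  set ε := S.gainCDF M k (c * S.lyrrcGain M k) with hε
  have hM0 : (0 : ℝ) < M := by exact_mod_cast (by omega : 0 < M)
  have hc0 : 0 < c := by positivity
  have hx := S.lyrrcGain_pos (by omega : 0 < M) k
  have hz : S.gainInvCDF M k ε = c * S.lyrrcGain M k :=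
    S.gainInvCDF_eq_of_gainCDF_eq (by linarith) (by positivity) rfl
  have hε0 : 0 < (ε : ℝ) := S.gainCDF_pos (by positivity)
  refine le_trans ?_ (latency_min_le hε1 (S.arrival_pos hM k))
  refine (iInf_le _ ε).trans ((iInf_le _ (S.lyrrcRate M k)).trans (iInf_le _
    ⟨S.isControl_lyrrcRate M k hε0 (by linarith) hε2.le, ?_⟩))
  refine (S.averagePower_lyrrcRate_le hM k hε1 (hz ▸ by positivity)).trans
    (ENNReal.ofReal_le_ofReal ?_)
  have hexc : 1 + 2 * (M * (ε : ℝ)) ≤ c := by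
    rw [hcdef]
    gcongr
    rw [le_inv_comm₀ (by positivity) (by positivity)]
    have : 2 * (M * (ε : ℝ)) * (M : ℝ) ^ 2 ≤ 1 := by nlinarith
    rwa [← one_div, le_div_iff₀ (by positivity), mul_comm]
  rw [hz]
  have hP := S.P_pos k
  calc S.P k * (S.lyrrcGain M k / (c * S.lyrrcGain M k)) * (1 + 2 * (M * (ε : ℝ)))
      ≤ S.P k * (S.lyrrcGain M k / (c * S.lyrrcGain M k)) * c := by gcongr
    _ = S.P k := by field_simp

lemma eventually_minLatency_ne_top (k : Fin K) : ∀ᶠ M in atTop, S.minLatency M k ≠ ∞ :=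
  (S.eventually_minLatency_le k).mono fun _ h => ne_top_of_le_ne_top ENNReal.ofReal_ne_top h

lemma tendsto_minLatency (k : Fin K) :
    Tendsto (fun M => ((S.minLatency M k).toReal - 1) / (S.lyrrcError M k : ℝ)) atTop
      (𝓝 1) := by
  set c : ℕ → ℝ := fun M => 1 + ((M : ℝ) ^ 2)⁻¹ with hcdef
  set F : ℕ → ℝ := fun M => S.gainCDF M k (c M * S.lyrrcGain M k) with hF
  have hinv : Tendsto (fun M : ℕ => ((M : ℝ))⁻¹) atTop (𝓝 0) :=
    tendsto_natCast_atTop_atTop.inv_tendsto_atTop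
  have hc : Tendsto c atTop (𝓝 1) := by
    simpa [hcdef] using (hinv.pow 2).const_add 1
  have hF0 : Tendsto F atTop (𝓝 0) := by
    simpa using S.tendsto_pow_mul_gainCDF_lyrrcGain k hc 0
  have hlim : Tendsto (fun M : ℕ => Real.exp (K * S.N * (M : ℝ)⁻¹) / (1 - 2 * F M)) atTop
      (𝓝 1) := by
    have h1 := (Real.continuous_exp.tendsto _).comp (hinv.const_mul ((K : ℝ) * S.N))
    have h2 := (hF0.const_mul 2).const_sub 1
    have h3 := h1.div h2 (by norm_num)
    simp only [mul_zero, Real.exp_zero, sub_zero, div_one] at h3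
    exact h3
  have hmain : ∀ᶠ M in atTop,
      1 ≤ ((S.minLatency M k).toReal - 1) / (S.lyrrcError M k : ℝ) ∧
      ((S.minLatency M k).toReal - 1) / (S.lyrrcError M k : ℝ) ≤
        Real.exp (K * S.N * (M : ℝ)⁻¹) / (1 - 2 * F M) := by
    filter_upwards [S.eventually_lyrrcError_mem k, S.eventually_minLatency_le k,
      hF0.eventually (gt_mem_nhds one_half_pos)] with M ⟨h1, h2, h3, _⟩ h5 h6
    have hM0 : (0 : ℝ) < M := by exact_mod_cast (by omega : 0 < M)
    have hF1 : 0 ≤ F M := (S.gainCDF M k _).2.1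
    have h7 : 0 < 1 - 2 * F M := by linarith
    obtain ⟨h8, h9⟩ := div_mem_Icc_of_latency_mem h3 (div_nonneg hF1 h7.le)
      (S.one_add_lyrrcError_le_minLatency h1 h2 k) h5
    refine ⟨h8, h9.trans ?_⟩
    rw [div_right_comm]
    gcongr
    rw [div_le_iff₀ h3]
    have h10 := S.gainCDF_mul_le (M := M) (k := k) (c := c M)
      (le_add_of_nonneg_right (by positivity)) (S.lyrrcGain M k)
    refine h10.trans ?_
    rw [← lyrrcError_eq]
    gcongr
    calc c M ^ (K * M * S.N) ≤ Real.exp (((M : ℝ) ^ 2)⁻¹) ^ (K * M * S.N) := by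
          refine pow_le_pow_left₀ (by positivity) ?_ _
          exact (add_comm _ _).trans_le (Real.add_one_le_exp _)
      _ = Real.exp (K * S.N * (M : ℝ)⁻¹) := by
          rw [← Real.exp_nat_mul]
          congr 1
          push_cast
          field_simp
  exact tendsto_of_tendsto_of_tendsto_of_le_of_le' tendsto_const_nhds hlim
    (hmain.mono fun _ h => h.1) (hmain.mono fun _ h => h.2)

end Uplink

end

theorem theorem4 {K : ℕ} (S : Uplink K) (ω : Fin K → ℝ) (hω : ∀ k, 0 < ω k) :
    -- decoupling into `K` single-user problems
    (∀ M : ℕ, 2 ≤ M → K ≤ M →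
      S.multiuserLatency ω M = ∑ k, ENNReal.ofReal (ω k) * S.minLatency M k) ∧
    ∀ k : Fin K,
      -- LYRRC is a control of user `k` for large `M` and meets the power budget asymptotically
      (∀ᶠ M in atTop, S.IsControl k (S.lyrrcError M k) (S.lyrrcRate M k)) ∧
      Tendsto (fun M => S.averagePower M k (S.lyrrcError M k) (S.lyrrcRate M k)) atTop
        (𝓝 (ENNReal.ofReal (S.P k))) ∧
      -- the latency achieved by LYRRC
      (∀ᶠ M in atTop, S.lyrrcLatency M k ≠ ∞) ∧
      Tendsto (fun M => ((S.lyrrcLatency M k).toReal - 1) / (S.lyrrcError M k : ℝ)) atTop (𝓝 1) ∧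
      -- the minimum latency
      (∀ᶠ M in atTop, S.minLatency M k ≠ ∞) ∧
      Tendsto (fun M => ((S.minLatency M k).toReal - 1) / (S.lyrrcError M k : ℝ)) atTop (𝓝 1) := by
  refine ⟨fun M _ hM => S.multiuserLatency_eq ω hω hM, fun k => ⟨?_,
    S.tendsto_averagePower_lyrrc k, S.eventually_lyrrcLatency_ne_top k, S.tendsto_lyrrcLatency k,
    S.eventually_minLatency_ne_top k, S.tendsto_minLatency k⟩⟩
  filter_upwards [S.eventually_lyrrcError_mem k,
    (S.tendsto_lyrrcError k).eventually (gt_mem_nhds (S.εmax_pos k))] with M ⟨_, _, h3, h4⟩ h5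
  exact S.isControl_lyrrcRate M k h3 (by linarith) h5.le
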